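/- **Conventions.** Let $\Bbbk$ be a field. Graded algebras are unital associative $\mathbb N$-graded $\Bbbk$-algebras $A=\bigoplus_{n\ge 0}A_n$ with $\dim A_n<\infty$. Operads are symmetric $\Bbbk$-operads $\mathcal P$ with $\mathcal P(0)=0$ and $\dim\mathcal P(n)<\infty$ for all $n$, with right actions $x\ast\sigma$ of $\mathbb S_n$ on $\mathcal P(n)$ and partial compositions $\circ_i$. $\mathcal P$ is *$\mathbb S$-trivial* (resp. *$\mathbb A$-trivial*) if for all $n$ every element of $\mathcal P(n)$ is fixed by $\mathbb S_n$ (resp. by the alternating group $\mathbb A_n$). *PGC algebras.* A *PGC algebra* is a graded algebra $A$ with decompositions $A_n=A_{n,e}\oplus A_{n,o}$ for $n\ge1$ such that $A_e=\bigoplus_{n\ge1}A_{n,e}$ and $A_o=\bigoplus_{n\ge1}A_{n,o}$ are two-sided ideals and $yz=(-1)^{\deg(y)\deg(z)t(y)t(z)}zy$ for all homogeneous $y,z\in A_0\cup A_e\cup A_o$, where $t=0$ on $A_0\cup A_e$ and $t=1$ on $A_o$. Homomorphisms of PGC algebras are homomorphisms of graded algebras that map $A_{n,e}$ into $B_{n,e}$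 and $A_{n,o}$ into $B_{n,o}$ for all $n\geq 1$. *Saturation.* $A_{\{w\}}\subseteq A$ is the graded subalgebra with $\Bbbk 1$ in degree $0$, zero in degrees $1,\dots,w-1$ and $A_n$ in the positive degrees $n\ge w$; $\mathcal P_{\{w\}}\subseteq\mathcal P$ is the suboperad with $\Bbbk 1_{\mathcal P}$ in arity $1$, zero in arities $2,\dots,w-1$ and $\mathcal P(n)$ in the arities $n\ge w$, $n\geq 2$. $A$ is *left torsionfree* if $x=0$ whenever $x \in A$ and $A_{\ge N}\,x=0$ for some $N$; $\mathcal P$ is *left torsionfree* if $x=0$ whenever $x\in \mathcal P$ and for some $N$ one has $z\circ_i x=0$ for all $n\ge N$, $z\in\mathcal P(n)$, $1\le i\le n$. An operad (resp. graded algebra, resp. PGC algebra) $X$ is *saturated* if it is left torsionfree and for every left torsionfree operad (resp. graded algebra, resp. PGC algebra) $Y$ and every $w>0$, each isomorphism $Y_{\{w\}}\to X_{\{w\}}$ of operads (resp. graded algebras, resp. PGC algebras) extends to an injective homomorphism $Y\to X$ of the same kind. *Primeness.* A graded algebra $A$ is *prime* if $IJ\ne0$ for all nonzero two-sided ideals $I,J$;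 an operad $\mathcal P$ is *prime* if for all nonzero ideals $I,J$ of $\mathcal P$ there are $x\in I$, $y\in J$ and $i$ with $x\circ_iy\neq0$. Infinite dimensional refers to $\bigoplus_n A_n$ and $\bigoplus_n\mathcal P(n)$. *Functors.* All functors below are the identity on the underlying linear maps. * $\mathcal F_{\mathbb S\mathbf{tr}}(\mathcal P)$, for an $\mathbb S$-trivial operad $\mathcal P$, is the graded algebra with $A_n=\mathcal P(n+1)$ and $x\cdot y=x\circ_1y$. For a commutative graded algebra $A$, $\mathcal G_{\mathbb S\mathbf{tr}}(A)$ is the operad with $\mathcal P(n+1)=A_n$, trivial $\mathbb S_{n+1}$-actions, identity $1_A$ and $x\circ_iy=xy$. * $\mathcal F_{\mathbb A\mathbf{tr}}(\mathcal P)$, for an $\mathbb A$-trivial operad $\mathcal P$, is the graded algebra with $A_n=\mathcal P(n+1)$ and $x\cdot y=x\circ_1y$, together with the subspaces (for $n\ge1$) $A_{n,e}=\{x: x\ast\sigma=x\ \forall\sigma\in\mathbb S_{n+1}\}$ and $A_{n,o}=\{x: x\ast\sigma=\operatorname{sgn}(\sigma)x\ \forall\sigma\in\mathbb S_{n+1}\}$.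 For a PGC algebra $A$, $\mathcal G_{\mathbb A\mathbf{tr}}(A)$ is the operad with $\mathcal P(n+1)=A_n$, identity $1_A$, where $\mathbb S_{n+1}$ acts trivially on $A_{n,e}$ and by the sign on $A_{n,o}$ ($n\geq 1$), and $x\circ_iy=xy$ for $x\in A_0\cup A_e$, $x\circ_iy=(-1)^{(i-1)\deg(y)}xy$ for homogeneous $x\in A_o$ and $y \in A$. **Theorem.** (A) Suppose $\operatorname{char}\Bbbk\ne2$. The functors $(\mathcal G_{\mathbb A\mathbf{tr}},\mathcal F_{\mathbb A\mathbf{tr}})$ restrict to 1. an equivalence between the category of saturated PGC algebras and the category of $\mathbb A$-trivial saturated operads, and 2. an equivalence between the category of infinite dimensional prime saturated PGC algebras and the category of $\mathbb A$-trivial infinite dimensional prime saturated operads. (B) Let $\operatorname{char}\Bbbk$ be arbitrary. The functors $(\mathcal G_{\mathbb S\mathbf{tr}},\mathcal F_{\mathbb S\mathbf{tr}})$ restrict to 1. an equivalence between the category of saturated (as graded algebras) commutative graded algebras and the category of $\mathbb S$-trivial saturated operads, and 2. an equivalence between the category of infinite dimensional prime saturated commutative graded algebras and the category of $\mathbb S$-trivial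 infinite dimensional prime saturated operads. Here "restrict" means that each functor of the pair maps the objects of one category to objects of the other, and that the two restricted functors are the functors of an equivalence of categories. -/

import Mathlib

open CategoryTheory DirectSum

universe u

noncomputable section

namespace GradedOperads

/-! ### Block permutations

All indices are zero-based.  Inserting an operation with `n + 1` inputs into the input `i` of an
operation with `m + 1` inputs gives an operation with `m + n + 1` inputs. -/

/-- The inputs of `x ∘ᵢ y`: either an input `j ≠ i` of `x` or an input of `y`; the inputs of `y`
occupy the consecutive places `i, …, i + n`. -/
def slotEquiv (m n : ℕ) (i : Fin (m + 1)) :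
    Fin (m + n + 1) ≃ {j : Fin (m + 1) // j ≠ i} ⊕ Fin (n + 1) where
  toFun p :=
    if h₁ : p.1 < i.1 then Sum.inl ⟨⟨p.1, by omega⟩, by simp only [ne_eq, Fin.ext_iff]; omega⟩
    else if h₂ : p.1 ≤ i.1 + n then Sum.inr ⟨p.1 - i.1, by omega⟩
    else Sum.inl ⟨⟨p.1 - n, by omega⟩, by simp only [ne_eq, Fin.ext_iff]; omega⟩
  invFun s := Sum.elim
    (fun j => if j.1.1 < i.1 then ⟨j.1.1, by omega⟩ else ⟨j.1.1 + n, by omega⟩)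
    (fun q => ⟨i.1 + q.1, by omega⟩) s
  left_inv p := by
    by_cases h₁ : p.1 < i.1
    · simp only [h₁, dite_true, Sum.elim_inl, if_true]
    · by_cases h₂ : p.1 ≤ i.1 + n
      · simp only [h₁, h₂, dite_true, dite_false, Sum.elim_inr, Fin.ext_iff]
        omega
      · have h₃ : ¬ (p.1 - n < i.1) := by omega
        simp only [h₁, h₂, h₃, dite_false, if_false, Sum.elim_inl, Fin.ext_iff]
        omega
  right_inv s := by
    rcases s with ⟨j, hj⟩ | q
    · have hj' : j.1 ≠ i.1 := fun h => hj (Fin.ext h)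
      by_cases h : j.1 < i.1
      · simp only [Sum.elim_inl, h, if_true, dite_true]
      · have h₁ : ¬ (j.1 + n < i.1) := by omega
        have h₂ : ¬ (j.1 + n ≤ i.1 + n) := by omega
        simp only [Sum.elim_inl, h, h₁, h₂, if_false, dite_false, Nat.add_sub_cancel]
    · have h₁ : ¬ (i.1 + q.1 < i.1) := by omega
      have h₂ : i.1 + q.1 ≤ i.1 + n := by omega
      simp only [Sum.elim_inr, h₁, h₂, dite_true, dite_false, Nat.add_sub_cancel_left]

/-- The permutation `σ'` of the inputs of `x ∘ᵢ y` induced by a permutation `σ` of the inputs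
of `y`. -/
def blockInner {m n : ℕ} (i : Fin (m + 1)) (σ : Equiv.Perm (Fin (n + 1))) :
    Equiv.Perm (Fin (m + n + 1)) :=
  ((slotEquiv m n i).trans (Equiv.sumCongr (Equiv.refl _) σ)).trans (slotEquiv m n i).symm

/-- The block permutation `φ''` induced by a permutation `φ` of the inputs of `x`: it moves the
block of the `n + 1` inputs of `y` from place `i` to place `φ i` without changing the order inside
the block, and acts like `φ` on the other inputs. -/
def blockOuter {m : ℕ} (n : ℕ) (φ : Equiv.Perm (Fin (m + 1))) (i : Fin (m + 1)) :
    Equiv.Perm (Fin (m + n + 1)) :=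
  ((slotEquiv m n i).trans (Equiv.sumCongr
    (φ.subtypeEquiv (p := fun j => j ≠ i) (q := fun j => j ≠ φ i) (by simp))
    (Equiv.refl (Fin (n + 1))))).trans (slotEquiv m n (φ i)).symm

theorem sign_blockInner {m n : ℕ} (i : Fin (m + 1)) (σ : Equiv.Perm (Fin (n + 1))) :
    Equiv.Perm.sign (blockInner i σ) = Equiv.Perm.sign σ := by
  unfold blockInner
  rw [Equiv.Perm.sign_trans_trans_symm]
  have := Equiv.Perm.sign_sumCongr (1 : Equiv.Perm {j : Fin (m + 1) // j ≠ i}) σ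
  rw [Equiv.Perm.sign_one, one_mul] at this
  exact this

/-- `slotEquiv` followed by the order-preserving renumbering of the inputs `j ≠ i` of `x`. -/
def slotSum (m n : ℕ) (i : Fin (m + 1)) : Fin (m + n + 1) ≃ Fin m ⊕ Fin (n + 1) :=
  (slotEquiv m n i).trans
    (Equiv.sumCongr (finSuccAboveEquiv i).symm (Equiv.refl (Fin (n + 1))))

theorem slotSum_symm_inl {m n : ℕ} (i : Fin (m + 1)) (a : Fin m) :
    ((slotSum m n i).symm (Sum.inl a)).1 = if a.1 < i.1 then a.1 else a.1 + 1 + n := by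
  have key : ((slotSum m n i).symm (Sum.inl a)).1 =
      if (i.succAbove a).1 < i.1 then (i.succAbove a).1 else (i.succAbove a).1 + n := by
    change (if (i.succAbove a).1 < i.1 then (⟨(i.succAbove a).1, _⟩ : Fin (m + n + 1))
      else ⟨(i.succAbove a).1 + n, _⟩).1 = _
    split_ifs <;> rfl
  rw [key]
  by_cases h : a.1 < i.1
  · have : i.succAbove a = a.castSucc := Fin.succAbove_of_castSucc_lt _ _ h
    rw [this]
    rw [if_pos h]
    exact if_pos h
  · have : i.succAbove a = a.succ := Fin.succAbove_of_le_castSucc _ _ (by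
      simpa [Fin.le_def] using h)
    have h' : ¬ (a.succ.1 < i.1) := by rw [Fin.val_succ]; omega
    rw [this, if_neg h, if_neg h', Fin.val_succ]

theorem slotSum_symm_inr {m n : ℕ} (i : Fin (m + 1)) (q : Fin (n + 1)) :
    ((slotSum m n i).symm (Sum.inr q)).1 = i.1 + q.1 := rfl

theorem slotSum_step (m n i : ℕ) (hi : i + 1 < m + 1) :
    (slotSum m n ⟨i, by omega⟩).trans (slotSum m n ⟨i + 1, hi⟩).symm =
      Fin.cycleIcc (⟨i, by omega⟩ : Fin (m + n + 1)) ⟨i + n + 1, by omega⟩ := by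
  refine Equiv.ext fun p => ?_
  obtain ⟨s, rfl⟩ := (slotSum m n ⟨i, by omega⟩).symm.surjective p
  rw [Equiv.trans_apply, Equiv.apply_symm_apply]
  apply Fin.ext
  rcases s with a | q
  · have e := slotSum_symm_inl (n := n) (⟨i, by omega⟩ : Fin (m + 1)) a
    rw [slotSum_symm_inl]
    by_cases h : a.1 < i
    · rw [if_pos (show a.1 < (⟨i, by omega⟩ : Fin (m + 1)).1 from h)] at e
      rw [Fin.cycleIcc_of_lt (by rw [Fin.lt_def, e]; exact h), e, if_pos (by simp only; omega)]
    · rw [if_neg (show ¬ a.1 < (⟨i, by omega⟩ : Fin (m + 1)).1 from h)] at e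
      by_cases h' : a.1 = i
      · have : (slotSum m n ⟨i, by omega⟩).symm (Sum.inl a) = ⟨i + n + 1, by omega⟩ := by
          apply Fin.ext; rw [e]; simp only; omega
        rw [this, Fin.cycleIcc_of_last (by rw [Fin.le_def]; simp only; omega),
          if_pos (by simp only; omega)]
        exact h'
      · rw [Fin.cycleIcc_of_gt (by rw [Fin.lt_def, e]; simp only; omega), e,
          if_neg (by simp only; omega)]
  · have e := slotSum_symm_inr (⟨i, by omega⟩ : Fin (m + 1)) q
    rw [slotSum_symm_inr, Fin.cycleIcc_of_ge_of_lt (by rw [Fin.le_def, e]; simp only; omega)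
      (by rw [Fin.lt_def, e]; simp only; omega), Fin.val_add_one_of_lt', e]
    · simp only; omega
    · rw [e]; simp only; omega

theorem sign_slotSum (m n i : ℕ) (hi : i < m + 1) :
    Equiv.Perm.sign ((slotSum m n 0).trans (slotSum m n ⟨i, hi⟩).symm) =
      (-1) ^ (i * (n + 1)) := by
  induction i with
  | zero =>
    have : (slotSum m n 0).trans (slotSum m n ⟨0, hi⟩).symm = 1 := Equiv.self_trans_symm _
    rw [this]; simp
  | succ i ih =>
    have h : (slotSum m n 0).trans (slotSum m n ⟨i + 1, hi⟩).symm =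
        ((slotSum m n ⟨i, by omega⟩).trans (slotSum m n ⟨i + 1, hi⟩).symm : Equiv.Perm _) *
        ((slotSum m n 0).trans (slotSum m n ⟨i, by omega⟩).symm : Equiv.Perm _) := by
      ext p; simp [Equiv.Perm.mul_apply]
    rw [h, map_mul, ih (by omega), slotSum_step,
      Fin.sign_cycleIcc_of_le (by rw [Fin.le_def]; simp only; omega), ← pow_add]
    congr 1
    simp only
    rw [show i + n + 1 - i = n + 1 by omega]; ring

/-- The permutation of `Fin m` induced by `φ` on the inputs `j ≠ i`. -/
def restPerm {m : ℕ} (φ : Equiv.Perm (Fin (m + 1))) (i : Fin (m + 1)) : Equiv.Perm (Fin m) :=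
  ((finSuccAboveEquiv i).trans
    (φ.subtypeEquiv (p := fun j => j ≠ i) (q := fun j => j ≠ φ i) (by simp))).trans
    (finSuccAboveEquiv (φ i)).symm

theorem sign_blockOuter_aux {m : ℕ} (n : ℕ) (φ : Equiv.Perm (Fin (m + 1))) (i : Fin (m + 1)) :
    Equiv.Perm.sign (blockOuter n φ i) =
      Equiv.Perm.sign (restPerm φ i) * (-1) ^ ((i.1 + (φ i).1) * (n + 1)) := by
  have h : blockOuter n φ i =
      ((slotSum m n 0).trans (slotSum m n (φ i)).symm : Equiv.Perm _) *
      (((slotSum m n 0).trans (Equiv.sumCongr (restPerm φ i) (Equiv.refl (Fin (n + 1))))).trans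
        (slotSum m n 0).symm : Equiv.Perm _) *
      ((slotSum m n 0).trans (slotSum m n i).symm : Equiv.Perm _)⁻¹ := by
    refine Equiv.ext fun p => ?_
    simp only [Equiv.Perm.mul_apply, Equiv.Perm.inv_def, Equiv.symm_trans_apply, Equiv.trans_apply,
      Equiv.symm_symm, Equiv.apply_symm_apply]
    simp only [slotSum, blockOuter, Equiv.trans_apply, Equiv.symm_trans_apply]
    rcases slotEquiv m n i p with j | q
    · simp [restPerm]
    · simp
  have hs := Equiv.Perm.sign_sumCongr (restPerm φ i) (1 : Equiv.Perm (Fin (n + 1)))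
  rw [Equiv.Perm.sign_one, mul_one] at hs
  rw [h, map_mul, map_mul, Equiv.Perm.sign_inv, Equiv.Perm.sign_trans_trans_symm,
    sign_slotSum m n (φ i).1 (φ i).2, sign_slotSum m n i.1 i.2]
  rw [show Equiv.sumCongr (restPerm φ i) (Equiv.refl (Fin (n + 1))) =
    Equiv.Perm.sumCongr (restPerm φ i) 1 from rfl, hs]
  rw [add_mul, pow_add]
  ac_rfl

theorem blockOuter_zero {m : ℕ} (φ : Equiv.Perm (Fin (m + 1))) (i : Fin (m + 1)) :
    blockOuter 0 φ i = φ := by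
  have hs : ∀ (i p : Fin (m + 1)) (h : p ≠ i), slotEquiv m 0 i p = Sum.inl ⟨p, h⟩ := by
    intro i p h
    rw [← Equiv.eq_symm_apply]
    apply Fin.ext
    change p.1 = (if p.1 < i.1 then (⟨p.1, _⟩ : Fin (m + 1)) else ⟨p.1 + 0, _⟩).1
    split_ifs <;> rfl
  have hr : ∀ i : Fin (m + 1), slotEquiv m 0 i i = Sum.inr 0 := by
    intro i
    rw [← Equiv.eq_symm_apply]
    exact Fin.ext rfl
  refine Equiv.ext fun p => ?_
  simp only [blockOuter, Equiv.trans_apply]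
  rw [Equiv.symm_apply_eq]
  by_cases h : p = i
  · subst h
    refine (congrArg _ (hr p)).trans ?_
    rw [hr]; rfl
  · refine (congrArg _ (hs i p h)).trans ?_
    rw [hs (φ i) (φ p) (by simpa using h)]; rfl

theorem sign_blockOuter {m : ℕ} (n : ℕ) (φ : Equiv.Perm (Fin (m + 1))) (i : Fin (m + 1)) :
    Equiv.Perm.sign (blockOuter n φ i) =
      Equiv.Perm.sign φ * (-1) ^ ((i.1 + (φ i).1) * n) := by
  have h₀ := sign_blockOuter_aux 0 φ i
  rw [blockOuter_zero] at h₀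
  rw [sign_blockOuter_aux, h₀, mul_add, pow_add]
  simp only [zero_add, mul_one]
  ac_rfl

/-! ### Operads -/

variable (k : Type u) [Field k]

/-- A reduced, locally finite, symmetric operad over `k`, in terms of partial compositions.
As `P(0) = 0`, only the components of positive arity are recorded: `ops n` is `P(n + 1)`, a
finite-dimensional right module over the symmetric group on `n + 1` letters, and
`comp i x y` is `x ∘ᵢ y` with `i` counted from zero.  Equations between operations whose arities
agree only propositionally are equations in the disjoint union of the components. -/
structure Operad where
  ops : ℕ → Type u
  [addCommGroup : ∀ n, AddCommGroup (ops n)]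
  [module : ∀ n, Module k (ops n)]
  [finite : ∀ n, Module.Finite k (ops n)]
  /-- `act σ x` is `x * σ`. -/
  act : ∀ {n : ℕ}, Equiv.Perm (Fin (n + 1)) → ops n →ₗ[k] ops n
  one : ops 0
  comp : ∀ {m n : ℕ}, Fin (m + 1) → ops m →ₗ[k] ops n →ₗ[k] ops (m + n)
  act_one : ∀ {n : ℕ} (x : ops n), act 1 x = x
  act_mul : ∀ {n : ℕ} (σ τ : Equiv.Perm (Fin (n + 1))) (x : ops n),
    act (σ * τ) x = act τ (act σ x)
  comp_one : ∀ {n : ℕ} (i : Fin (n + 1)) (x : ops n), comp i x one = x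
  one_comp : ∀ {n : ℕ} (x : ops n), (⟨0 + n, comp 0 one x⟩ : Σ n, ops n) = ⟨n, x⟩
  comp_assoc : ∀ {l m n : ℕ} (i : Fin (l + 1)) (j : Fin (m + 1))
    (x : ops l) (y : ops m) (z : ops n),
    (⟨l + m + n, comp ⟨i.1 + j.1, by omega⟩ (comp i x y) z⟩ : Σ n, ops n) =
      ⟨l + (m + n), comp i x (comp j y z)⟩
  comp_comm : ∀ {l m n : ℕ} (i j : Fin (l + 1)), i < j →
    ∀ (x : ops l) (y : ops m) (z : ops n),
    (⟨l + m + n, comp ⟨j.1 + m, by omega⟩ (comp i x y) z⟩ : Σ n, ops n) =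
      ⟨l + n + m, comp ⟨i.1, by omega⟩ (comp j x z) y⟩
  comp_act : ∀ {m n : ℕ} (i : Fin (m + 1)) (σ : Equiv.Perm (Fin (n + 1)))
    (x : ops m) (y : ops n), comp i x (act σ y) = act (blockInner i σ) (comp i x y)
  act_comp : ∀ {m n : ℕ} (i : Fin (m + 1)) (φ : Equiv.Perm (Fin (m + 1)))
    (x : ops m) (y : ops n), comp i (act φ x) y = act (blockOuter n φ i) (comp (φ i) x y)

attribute [instance] Operad.addCommGroup Operad.module Operad.finite

variable {k}

namespace Operad

/-- A morphism of operads. -/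
@[ext]
structure Hom (P Q : Operad k) where
  app : ∀ n, P.ops n →ₗ[k] Q.ops n
  map_one : app 0 P.one = Q.one
  map_act : ∀ {n : ℕ} (σ : Equiv.Perm (Fin (n + 1))) (x : P.ops n),
    app n (P.act σ x) = Q.act σ (app n x)
  map_comp : ∀ {m n : ℕ} (i : Fin (m + 1)) (x : P.ops m) (y : P.ops n),
    app (m + n) (P.comp i x y) = Q.comp i (app m x) (app n y)

instance : Category (Operad k) where
  Hom P Q := Hom P Q
  id P :=
    { app := fun _ => LinearMap.id
      map_one := rfl
      map_act := fun _ _ => rfl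
      map_comp := fun _ _ _ => rfl }
  comp f g :=
    { app := fun n => (g.app n).comp (f.app n)
      map_one := by simp [f.map_one, g.map_one]
      map_act := fun σ x => by simp [f.map_act, g.map_act]
      map_comp := fun i x y => by simp [f.map_comp, g.map_comp] }
  id_comp _ := rfl
  comp_id _ := rfl
  assoc _ _ _ := rfl

theorem sigma_subtype_ext {A : ℕ → Type u} [∀ n, AddCommGroup (A n)] [∀ n, Module k (A n)]
    {S : ∀ n, Submodule k (A n)} {a b : ℕ} {x : S a} {y : S b}
    (h : (⟨a, x.1⟩ : Σ n, A n) = ⟨b, y.1⟩) : (⟨a, x⟩ : Σ n, S n) = ⟨b, y⟩ := by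
  have hab : a = b := congrArg Sigma.fst h
  subst hab
  have : x.1 = y.1 := by simpa using h
  rw [Subtype.ext this]

/-- The suboperad on a family of subspaces that contains the identity and is stable under the
symmetric groups and under all partial compositions. -/
abbrev sub (P : Operad k) (S : ∀ n, Submodule k (P.ops n)) (h₁ : P.one ∈ S 0)
    (hact : ∀ {n : ℕ} (σ : Equiv.Perm (Fin (n + 1))), ∀ x ∈ S n, P.act σ x ∈ S n)
    (hcomp : ∀ {m n : ℕ} (i : Fin (m + 1)), ∀ x ∈ S m, ∀ y ∈ S n, P.comp i x y ∈ S (m + n)) :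
    Operad k where
  ops n := S n
  act σ := (P.act σ).restrict (hact σ)
  one := ⟨P.one, h₁⟩
  comp {m n} i := LinearMap.mk₂ k
    (fun (x : S m) (y : S n) => (⟨P.comp i x.1 y.1, hcomp i x.1 x.2 y.1 y.2⟩ : S (m + n)))
    (fun _ _ _ => Subtype.ext (by simp)) (fun _ _ _ => Subtype.ext (by simp))
    (fun _ _ _ => Subtype.ext (by simp)) (fun _ _ _ => Subtype.ext (by simp))
  act_one x := Subtype.ext (P.act_one x.1)
  act_mul σ τ x := Subtype.ext (P.act_mul σ τ x.1)
  comp_one i x := Subtype.ext (P.comp_one i x.1)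
  one_comp x := sigma_subtype_ext (P.one_comp x.1)
  comp_assoc i j x y z := sigma_subtype_ext (P.comp_assoc i j x.1 y.1 z.1)
  comp_comm i j hij x y z := sigma_subtype_ext (P.comp_comm i j hij x.1 y.1 z.1)
  comp_act i σ x y := Subtype.ext (P.comp_act i σ x.1 y.1)
  act_comp i φ x y := Subtype.ext (P.act_comp i φ x.1 y.1)

/-- The components of the suboperad `P_{w}`: the line spanned by the identity in arity `1`, zero
in the arities `2, …, w - 1`, and everything in the arities `≥ w` (and `≥ 2`). -/
def truncOps (P : Operad k) (w : ℕ) : ∀ n, Submodule k (P.ops n)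
  | 0 => k ∙ P.one
  | n + 1 => if w ≤ n + 2 then ⊤ else ⊥

theorem truncOps_of_le (P : Operad k) {w n : ℕ} (h : w ≤ n + 1) (hn : n ≠ 0) :
    P.truncOps w n = ⊤ := by
  obtain ⟨n, rfl⟩ := Nat.exists_eq_succ_of_ne_zero hn
  exact if_pos h

theorem truncOps_of_lt (P : Operad k) {w n : ℕ} (h : n + 1 < w) (hn : n ≠ 0) :
    P.truncOps w n = ⊥ := by
  obtain ⟨n, rfl⟩ := Nat.exists_eq_succ_of_ne_zero hn
  exact if_neg (by omega)

/-- The suboperad `P_{w}`. -/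
abbrev trunc (P : Operad k) (w : ℕ) : Operad k :=
  P.sub (P.truncOps w) (Submodule.mem_span_singleton_self _)
    (by
      intro n σ x hx
      rcases Nat.eq_zero_or_pos n with rfl | hn
      · have : σ = 1 := Equiv.ext fun i => Fin.ext (by omega)
        rw [this, P.act_one]; exact hx
      · by_cases h : w ≤ n + 1
        · rw [truncOps_of_le P h hn.ne']; trivial
        · rw [truncOps_of_lt P (by omega) hn.ne', Submodule.mem_bot] at hx
          rw [hx, map_zero]; exact Submodule.zero_mem _)
    (by
      intro m n i x hx y hy
      rcases Nat.eq_zero_or_pos n with rfl | hn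
      · obtain ⟨c, rfl⟩ := Submodule.mem_span_singleton.1 hy
        rw [map_smul, P.comp_one]
        exact Submodule.smul_mem _ _ hx
      · by_cases h : w ≤ m + n + 1
        · rw [truncOps_of_le P h (by omega)]; trivial
        · rw [truncOps_of_lt P (n := n) (by omega) hn.ne', Submodule.mem_bot] at hy
          rw [hy, map_zero]; exact Submodule.zero_mem _)

/-- `P` is left torsionfree: an element `x` with `P_{≥ N} ∘ (k x) = 0` for some `N` is zero. -/
def LeftTorsionfree (P : Operad k) : Prop :=
  ∀ (m : ℕ) (x : P.ops m),
    (∃ N : ℕ, ∀ n, N ≤ n → ∀ (i : Fin (n + 1)) (z : P.ops n), P.comp i z x = 0) → x = 0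

/-- `P` is saturated: it is left torsionfree, and for every left torsionfree operad `Q`, every
isomorphism `φ : Q_{w} ≅ P_{w}` with `w > 0` extends to an injective morphism `Q ⟶ P`. -/
def IsSaturated (P : Operad k) : Prop :=
  P.LeftTorsionfree ∧
    ∀ Q : Operad k, Q.LeftTorsionfree → ∀ w : ℕ, 0 < w → ∀ φ : Q.trunc w ≅ P.trunc w,
      ∃ ψ : Q ⟶ P, (∀ n, Function.Injective (ψ.app n)) ∧
        ∀ (n : ℕ) (x : Q.truncOps w n), ψ.app n x.1 = (φ.hom.app n x).1

/-- A (two-sided) ideal of an operad. -/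
structure TwoSidedIdeal (P : Operad k) where
  carrier : ∀ n, Submodule k (P.ops n)
  act_mem : ∀ {n : ℕ} (σ : Equiv.Perm (Fin (n + 1))), ∀ x ∈ carrier n, P.act σ x ∈ carrier n
  comp_mem_left : ∀ {m n : ℕ} (i : Fin (m + 1)) (z : P.ops m), ∀ x ∈ carrier n,
    P.comp i z x ∈ carrier (m + n)
  comp_mem_right : ∀ {m n : ℕ} (i : Fin (m + 1)), ∀ x ∈ carrier m, ∀ z : P.ops n,
    P.comp i x z ∈ carrier (m + n)

/-- `P` is prime: `I ∘ J ≠ 0` for all nonzero ideals `I`, `J`.  Here `I ∘ J` is generated, as a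
family of representations of the symmetric groups, by the elements `x ∘ᵢ y` with `x ∈ I` and
`y ∈ J`, so it is nonzero if and only if one of these elements is. -/
def IsPrime (P : Operad k) : Prop :=
  ∀ I J : P.TwoSidedIdeal, (∃ n, I.carrier n ≠ ⊥) → (∃ n, J.carrier n ≠ ⊥) →
    ∃ (m n : ℕ) (i : Fin (m + 1)), ∃ x ∈ I.carrier m, ∃ y ∈ J.carrier n, P.comp i x y ≠ 0

/-- The total space of `P` is infinite dimensional. -/
def InfiniteDimensional (P : Operad k) : Prop :=
  ¬ Module.Finite k (⨁ n, P.ops n)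

variable (k) in
/-- All elements are fixed by the symmetric groups. -/
def isSTrivial : ObjectProperty (Operad k) := fun P =>
  ∀ (n : ℕ) (σ : Equiv.Perm (Fin (n + 1))) (x : P.ops n), P.act σ x = x

variable (k) in
/-- All elements are fixed by the alternating groups. -/
def isATrivial : ObjectProperty (Operad k) := fun P =>
  ∀ (n : ℕ) (σ : Equiv.Perm (Fin (n + 1))), σ ∈ alternatingGroup (Fin (n + 1)) →
    ∀ x : P.ops n, P.act σ x = x

end Operad

/-! ### Graded algebras -/

variable (k) in
/-- A locally finite, associative, unital `ℕ`-graded algebra. -/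
structure GrAlg where
  deg : ℕ → Type u
  [addCommGroup : ∀ n, AddCommGroup (deg n)]
  [module : ∀ n, Module k (deg n)]
  [finite : ∀ n, Module.Finite k (deg n)]
  [gring : DirectSum.GRing deg]
  [galgebra : DirectSum.GAlgebra k deg]

attribute [instance] GrAlg.addCommGroup GrAlg.module GrAlg.finite GrAlg.gring GrAlg.galgebra

/-- The structure of an external graded ring given by a bilinear multiplication. -/
abbrev gringOfMul {A : ℕ → Type u} [∀ n, AddCommGroup (A n)] [∀ n, Module k (A n)]
    (one : A 0) (mul : ∀ {m n : ℕ}, A m →ₗ[k] A n →ₗ[k] A (m + n))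
    (one_mul : ∀ {n : ℕ} (x : A n), (⟨0 + n, mul one x⟩ : Σ n, A n) = ⟨n, x⟩)
    (mul_one : ∀ {n : ℕ} (x : A n), mul x one = x)
    (mul_assoc : ∀ {l m n : ℕ} (x : A l) (y : A m) (z : A n),
      (⟨l + m + n, mul (mul x y) z⟩ : Σ n, A n) = ⟨l + (m + n), mul x (mul y z)⟩) :
    DirectSum.GRing A :=
  letI : GradedMonoid.GMul A := ⟨fun x y => mul x y⟩
  letI : GradedMonoid.GOne A := ⟨one⟩
  { mul_zero := fun _ => map_zero _
    zero_mul := fun {i j} y => LinearMap.congr_fun (map_zero (mul (m := i) (n := j))) y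
    mul_add := fun _ _ _ => map_add _ _ _
    add_mul := fun {i j} x x' y => LinearMap.congr_fun (map_add (mul (m := i) (n := j)) x x') y
    one_mul := fun x => one_mul x.2
    mul_one := fun x => congrArg (Sigma.mk x.1) (mul_one x.2)
    mul_assoc := fun x y z => mul_assoc x.2 y.2 z.2
    natCast := fun n => n • one
    natCast_zero := zero_smul _ _
    natCast_succ := fun n => succ_nsmul _ _
    intCast := fun n => n • one
    intCast_ofNat := fun n => natCast_zsmul _ _
    intCast_negSucc_ofNat := fun n => negSucc_zsmul _ _ }

/-- `gringOfMul` as a graded algebra. -/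
abbrev GrAlg.ofMul {A : ℕ → Type u} [∀ n, AddCommGroup (A n)] [∀ n, Module k (A n)]
    [∀ n, Module.Finite k (A n)]
    (one : A 0) (mul : ∀ {m n : ℕ}, A m →ₗ[k] A n →ₗ[k] A (m + n))
    (one_mul : ∀ {n : ℕ} (x : A n), (⟨0 + n, mul one x⟩ : Σ n, A n) = ⟨n, x⟩)
    (mul_one : ∀ {n : ℕ} (x : A n), mul x one = x)
    (mul_assoc : ∀ {l m n : ℕ} (x : A l) (y : A m) (z : A n),
      (⟨l + m + n, mul (mul x y) z⟩ : Σ n, A n) = ⟨l + (m + n), mul x (mul y z)⟩) :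
    GrAlg k :=
  letI := gringOfMul one mul one_mul mul_one mul_assoc
  { deg := A
    galgebra :=
      { toFun := (LinearMap.toSpanSingleton k (A 0) one).toAddMonoidHom
        map_one := one_smul _ _
        map_mul := fun r s => congrArg (Sigma.mk 0) (by
          change (r * s) • one = mul (r • one) (s • one)
          rw [map_smul, map_smul, LinearMap.smul_apply, mul_one, smul_smul, mul_comm])
        commutes := fun r x => by
          obtain ⟨n, x⟩ := x
          change (⟨0 + n, mul (r • one) x⟩ : Σ n, A n) = ⟨n, mul x (r • one)⟩
          rw [map_smul, map_smul, LinearMap.smul_apply, mul_one, ← LinearMap.map_smul]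
          exact one_mul _
        smul_def := fun r x => by
          obtain ⟨n, x⟩ := x
          change (⟨n, r • x⟩ : Σ n, A n) = ⟨0 + n, mul (r • one) x⟩
          rw [map_smul, LinearMap.smul_apply, ← LinearMap.map_smul]
          exact (one_mul _).symm } }

namespace GrAlg

/-- The total algebra `⨁ₙ Aₙ`. -/
abbrev Total (A : GrAlg k) : Type u := ⨁ n, A.deg n

/-- The unit element, in degree `0`. -/
abbrev one (A : GrAlg k) : A.deg 0 := GradedMonoid.GOne.one

/-- The multiplication `A_m × A_n → A_{m+n}`. -/
abbrev mul (A : GrAlg k) {m n : ℕ} : A.deg m →ₗ[k] A.deg n →ₗ[k] A.deg (m + n) :=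
  DirectSum.gMulLHom k A.deg

theorem one_mul (A : GrAlg k) {n : ℕ} (x : A.deg n) :
    (⟨0 + n, A.mul A.one x⟩ : Σ n, A.deg n) = ⟨n, x⟩ :=
  GradedMonoid.GMonoid.one_mul (⟨n, x⟩ : GradedMonoid A.deg)

theorem mul_one (A : GrAlg k) {n : ℕ} (x : A.deg n) : A.mul x A.one = x := by
  have := GradedMonoid.GMonoid.mul_one (⟨n, x⟩ : GradedMonoid A.deg)
  exact eq_of_heq (Sigma.mk.inj this).2

theorem mul_assoc (A : GrAlg k) {l m n : ℕ} (x : A.deg l) (y : A.deg m) (z : A.deg n) :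
    (⟨l + m + n, A.mul (A.mul x y) z⟩ : Σ n, A.deg n) = ⟨l + (m + n), A.mul x (A.mul y z)⟩ :=
  GradedMonoid.GMonoid.mul_assoc (⟨l, x⟩ : GradedMonoid A.deg) ⟨m, y⟩ ⟨n, z⟩

/-- A homomorphism of `ℕ`-graded algebras. -/
@[ext]
structure Hom (A B : GrAlg k) where
  app : ∀ n, A.deg n →ₗ[k] B.deg n
  map_one : app 0 A.one = B.one
  map_mul : ∀ {m n : ℕ} (x : A.deg m) (y : A.deg n),
    app (m + n) (A.mul x y) = B.mul (app m x) (app n y)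

instance : Category (GrAlg k) where
  Hom A B := Hom A B
  id A :=
    { app := fun _ => LinearMap.id
      map_one := rfl
      map_mul := fun _ _ => rfl }
  comp f g :=
    { app := fun n => (g.app n).comp (f.app n)
      map_one := by rw [LinearMap.comp_apply, f.map_one, g.map_one]
      map_mul := fun x y => by
        rw [LinearMap.comp_apply, f.map_mul, g.map_mul]; rfl }
  id_comp _ := rfl
  comp_id _ := rfl
  assoc _ _ _ := rfl

/-- The graded subalgebra on a family of subspaces that contains `1` and is stable under
multiplication. -/
abbrev sub (A : GrAlg k) (S : ∀ n, Submodule k (A.deg n)) (h₁ : A.one ∈ S 0)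
    (hmul : ∀ {m n : ℕ}, ∀ x ∈ S m, ∀ y ∈ S n, A.mul x y ∈ S (m + n)) : GrAlg k :=
  GrAlg.ofMul (A := fun n => S n) ⟨A.one, h₁⟩
    (fun {m n} => LinearMap.mk₂ k
      (fun (x : S m) (y : S n) => (⟨A.mul x.1 y.1, hmul x.1 x.2 y.1 y.2⟩ : S (m + n)))
      (fun x x' y => Subtype.ext (by
        simp only [Submodule.coe_add, map_add, LinearMap.add_apply]))
      (fun c x y => Subtype.ext (by
        simp only [Submodule.coe_smul, map_smul, LinearMap.smul_apply]))
      (fun x y y' => Subtype.ext (by simp only [Submodule.coe_add, map_add]))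
      (fun c x y => Subtype.ext (by simp only [Submodule.coe_smul, map_smul])))
    (fun x => Operad.sigma_subtype_ext (A.one_mul x.1))
    (fun x => Subtype.ext (A.mul_one x.1))
    (fun x y z => Operad.sigma_subtype_ext (A.mul_assoc x.1 y.1 z.1))

/-- The components of the graded subalgebra `A_{w}`: the line spanned by `1` in degree `0`, zero
in the degrees `1, …, w - 1`, and everything in the positive degrees `≥ w`. -/
def truncDeg (A : GrAlg k) (w : ℕ) : ∀ n, Submodule k (A.deg n)
  | 0 => k ∙ A.one
  | n + 1 => if w ≤ n + 1 then ⊤ else ⊥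

theorem truncDeg_of_le (A : GrAlg k) {w n : ℕ} (h : w ≤ n) (hn : n ≠ 0) :
    A.truncDeg w n = ⊤ := by
  obtain ⟨n, rfl⟩ := Nat.exists_eq_succ_of_ne_zero hn
  exact if_pos h

theorem truncDeg_of_lt (A : GrAlg k) {w n : ℕ} (h : n < w) (hn : n ≠ 0) :
    A.truncDeg w n = ⊥ := by
  obtain ⟨n, rfl⟩ := Nat.exists_eq_succ_of_ne_zero hn
  exact if_neg (by omega)

theorem mul_mem_truncDeg (A : GrAlg k) (w : ℕ) {m n : ℕ} (x : A.deg m) (hx : x ∈ A.truncDeg w m)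
    (y : A.deg n) (hy : y ∈ A.truncDeg w n) : A.mul x y ∈ A.truncDeg w (m + n) := by
  rcases Nat.eq_zero_or_pos n with rfl | hn
  · obtain ⟨c, rfl⟩ := Submodule.mem_span_singleton.1 hy
    rw [map_smul, A.mul_one]
    exact Submodule.smul_mem _ _ hx
  · by_cases h : w ≤ m + n
    · rw [truncDeg_of_le A h (by omega)]; trivial
    · rw [truncDeg_of_lt A (n := n) (by omega) hn.ne', Submodule.mem_bot] at hy
      rw [hy, map_zero]; exact Submodule.zero_mem _

/-- The graded subalgebra `A_{w}`. -/
abbrev trunc (A : GrAlg k) (w : ℕ) : GrAlg k :=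
  A.sub (A.truncDeg w) (Submodule.mem_span_singleton_self _)
    (fun x hx y hy => A.mul_mem_truncDeg w x hx y hy)

/-- `A` is left torsionfree: an element `x` with `A_{≥ N} x = 0` for some `N` is zero. -/
def LeftTorsionfree (A : GrAlg k) : Prop :=
  ∀ x : A.Total, (∃ N : ℕ, ∀ n, N ≤ n → ∀ z : A.deg n, DirectSum.of A.deg n z * x = 0) → x = 0

/-- `A` is saturated: it is left torsionfree, and for every left torsionfree graded algebra `B`,
every isomorphism `φ : B_{w} ≅ A_{w}` with `w > 0` extends to an injective homomorphism
`B ⟶ A`. -/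
def IsSaturated (A : GrAlg k) : Prop :=
  A.LeftTorsionfree ∧
    ∀ B : GrAlg k, B.LeftTorsionfree → ∀ w : ℕ, 0 < w → ∀ φ : B.trunc w ≅ A.trunc w,
      ∃ ψ : B ⟶ A, (∀ n, Function.Injective (ψ.app n)) ∧
        ∀ (n : ℕ) (x : B.truncDeg w n), ψ.app n x.1 = (φ.hom.app n x).1

/-- `A` is prime: the product of two nonzero two-sided ideals is nonzero. -/
def IsPrime (A : GrAlg k) : Prop :=
  ∀ I J : _root_.TwoSidedIdeal A.Total, I ≠ ⊥ → J ≠ ⊥ → ∃ x ∈ I, ∃ y ∈ J, x * y ≠ 0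

/-- `A` is infinite dimensional. -/
def InfiniteDimensional (A : GrAlg k) : Prop := ¬ Module.Finite k A.Total

variable (k) in
/-- `A` is commutative. -/
def isComm : ObjectProperty (GrAlg k) := fun A => ∀ x y : A.Total, x * y = y * x

end GrAlg

/-! ### Pseudo-graded commutative algebras -/

variable (k) in
/-- A graded algebra `A` together with graded subspaces `A_e = ⨁_{n ≥ 1} A_{n,e}` (`even`) and
`A_o = ⨁_{n ≥ 1} A_{n,o}` (`odd`) that live in positive degrees. -/
structure TypedGrAlg extends GrAlg k where
  even : ∀ n, Submodule k (deg n)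
  odd : ∀ n, Submodule k (deg n)
  even_zero : even 0 = ⊥
  odd_zero : odd 0 = ⊥

namespace TypedGrAlg

/-- A homomorphism of graded algebras that respects the types of homogeneous elements. -/
@[ext]
structure Hom (A B : TypedGrAlg k) extends GrAlg.Hom A.toGrAlg B.toGrAlg where
  map_even : ∀ n, ∀ x ∈ A.even n, app n x ∈ B.even n
  map_odd : ∀ n, ∀ x ∈ A.odd n, app n x ∈ B.odd n

instance : Category (TypedGrAlg k) where
  Hom A B := Hom A B
  id A :=
    { toHom := 𝟙 A.toGrAlg
      map_even := fun _ _ h => h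
      map_odd := fun _ _ h => h }
  comp {A B C} f g :=
    { toHom := CategoryStruct.comp (X := A.toGrAlg) (Y := B.toGrAlg) (Z := C.toGrAlg)
        f.toHom g.toHom
      map_even := fun n x h => g.map_even n _ (f.map_even n x h)
      map_odd := fun n x h => g.map_odd n _ (f.map_odd n x h) }
  id_comp _ := rfl
  comp_id _ := rfl
  assoc _ _ _ := rfl

/-- `A.HasType n t x` means that `x ∈ A_n` lies in `A_0 ∪ A_e ∪ A_o` and `t(x) = t`: it is `0`
on `A_0` and on `A_{n,e}`, and `1` on `A_{n,o}`. -/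
def HasType (A : TypedGrAlg k) (n t : ℕ) (x : A.deg n) : Prop :=
  (t = 0 ∧ (n = 0 ∨ x ∈ A.even n)) ∨ (t = 1 ∧ x ∈ A.odd n)

/-- `A` is a pseudo-graded commutative algebra: `A_n = A_{n,e} ⊕ A_{n,o}` for `n ≥ 1`, both `A_e`
and `A_o` are two-sided ideals, and `y z = (-1)^{deg(y) deg(z) t(y) t(z)} z y` for all homogeneous
`y, z` in `A_0 ∪ A_e ∪ A_o`. -/
structure IsPGC (A : TypedGrAlg k) : Prop where
  isCompl : ∀ n, n ≠ 0 → IsCompl (A.even n) (A.odd n)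
  mul_even : ∀ {m n : ℕ} (x : A.deg m), ∀ y ∈ A.even n, A.mul x y ∈ A.even (m + n)
  even_mul : ∀ {m n : ℕ}, ∀ x ∈ A.even m, ∀ y : A.deg n, A.mul x y ∈ A.even (m + n)
  mul_odd : ∀ {m n : ℕ} (x : A.deg m), ∀ y ∈ A.odd n, A.mul x y ∈ A.odd (m + n)
  odd_mul : ∀ {m n : ℕ}, ∀ x ∈ A.odd m, ∀ y : A.deg n, A.mul x y ∈ A.odd (m + n)
  comm : ∀ {m n s t : ℕ} (y : A.deg m) (z : A.deg n), A.HasType m s y → A.HasType n t z →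
    DirectSum.of A.deg m y * DirectSum.of A.deg n z =
      (-1) ^ (m * n * s * t) * (DirectSum.of A.deg n z * DirectSum.of A.deg m y)

variable (k) in
/-- The PGC algebras. -/
def isPGC : ObjectProperty (TypedGrAlg k) := fun A => A.IsPGC

/-- The subalgebra `A_{w}` with the induced types. -/
abbrev trunc (A : TypedGrAlg k) (w : ℕ) : TypedGrAlg k where
  toGrAlg := A.toGrAlg.trunc w
  even n := (A.even n).comap (A.truncDeg w n).subtype
  odd n := (A.odd n).comap (A.truncDeg w n).subtype
  even_zero := by
    rw [A.even_zero]; exact (Submodule.comap_bot _).trans (Submodule.ker_subtype _)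
  odd_zero := by
    rw [A.odd_zero]; exact (Submodule.comap_bot _).trans (Submodule.ker_subtype _)

/-- `A` is a saturated PGC algebra: it is a left torsionfree PGC algebra, and for every left
torsionfree PGC algebra `B`, every isomorphism `φ : B_{w} ≅ A_{w}` of PGC algebras with `w > 0`
extends to an injective homomorphism `B ⟶ A` of PGC algebras. -/
def IsSaturatedPGC (A : TypedGrAlg k) : Prop :=
  A.IsPGC ∧ A.LeftTorsionfree ∧
    ∀ B : TypedGrAlg k, B.IsPGC → B.LeftTorsionfree → ∀ w : ℕ, 0 < w →
      ∀ φ : B.trunc w ≅ A.trunc w,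
        ∃ ψ : B ⟶ A, (∀ n, Function.Injective (ψ.app n)) ∧
          ∀ (n : ℕ) (x : B.truncDeg w n), ψ.app n x.1 = (φ.hom.app n x).1

end TypedGrAlg

/-! ### The functors from operads to graded algebras -/

namespace Operad

/-- The graded algebra `A_P`: `(A_P)_n = P(n + 1)` and `x · y = x ∘₁ y`. -/
abbrev toGrAlg (P : Operad k) : GrAlg k :=
  GrAlg.ofMul (A := P.ops) P.one (fun {_ _} => P.comp 0) P.one_comp (P.comp_one 0)
    (fun x y z => P.comp_assoc 0 0 x y z)

/-- In the arities `n + 1 ≥ 2`: the elements that are fixed by the symmetric group. -/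
def evenOps (P : Operad k) : ∀ n, Submodule k (P.ops n)
  | 0 => ⊥
  | n + 1 =>
    { carrier := {x | ∀ σ : Equiv.Perm (Fin (n + 1 + 1)), P.act σ x = x}
      add_mem' := fun hx hy σ => by rw [map_add, hx σ, hy σ]
      zero_mem' := fun _ => map_zero _
      smul_mem' := fun c x hx σ => by rw [map_smul, hx σ] }

/-- In the arities `n + 1 ≥ 2`: the elements on which the symmetric group acts by the sign. -/
def oddOps (P : Operad k) : ∀ n, Submodule k (P.ops n)
  | 0 => ⊥
  | n + 1 =>
    { carrier := {x | ∀ σ : Equiv.Perm (Fin (n + 1 + 1)),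
        P.act σ x = ((Equiv.Perm.sign σ : ℤ) : k) • x}
      add_mem' := fun hx hy σ => by rw [map_add, hx σ, hy σ, smul_add]
      zero_mem' := fun _ => by rw [map_zero, smul_zero]
      smul_mem' := fun c x hx σ => by rw [map_smul, hx σ, smul_comm] }

theorem Hom.map_evenOps {P Q : Operad k} (f : Hom P Q) :
    ∀ n, ∀ x ∈ P.evenOps n, f.app n x ∈ Q.evenOps n
  | 0, x, hx => by
    have : x = 0 := hx
    rw [this, map_zero]; exact Submodule.zero_mem _
  | n + 1, x, hx => fun σ => by rw [← f.map_act, hx σ]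

theorem Hom.map_oddOps {P Q : Operad k} (f : Hom P Q) :
    ∀ n, ∀ x ∈ P.oddOps n, f.app n x ∈ Q.oddOps n
  | 0, x, hx => by
    have : x = 0 := hx
    rw [this, map_zero]; exact Submodule.zero_mem _
  | n + 1, x, hx => fun σ => by rw [← f.map_act, hx σ, map_smul]

/-- The graded algebra `A_P`, with the elements of `evenOps` and `oddOps` as the elements of even
and of odd type. -/
abbrev toTypedGrAlg (P : Operad k) : TypedGrAlg k where
  toGrAlg := P.toGrAlg
  even := P.evenOps
  odd := P.oddOps
  even_zero := rfl
  odd_zero := rfl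

end Operad

variable (k) in
/-- The functor `F_Str` from `S`-trivial operads to graded algebras, `P ↦ A_P`. -/
def FStr : (Operad.isSTrivial k).FullSubcategory ⥤ GrAlg k where
  obj P := P.obj.toGrAlg
  map f :=
    { app := f.hom.app
      map_one := f.hom.map_one
      map_mul := f.hom.map_comp 0 }

variable (k) in
/-- The functor `F_Atr` from `A`-trivial operads to graded algebras with types. -/
def FAtr : (Operad.isATrivial k).FullSubcategory ⥤ TypedGrAlg k where
  obj P := P.obj.toTypedGrAlg
  map f :=
    { app := f.hom.app
      map_one := f.hom.map_one
      map_mul := f.hom.map_comp 0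
      map_even := f.hom.map_evenOps
      map_odd := f.hom.map_oddOps }

/-! ### The functors from graded algebras to operads -/

theorem sigma_ext_of {A : ℕ → Type u} [∀ n, AddCommGroup (A n)] {m n : ℕ} {x : A m} {y : A n}
    (h : m = n) (hxy : DirectSum.of A m x = DirectSum.of A n y) :
    (⟨m, x⟩ : Σ n, A n) = ⟨n, y⟩ := by
  subst h
  rw [DirectSum.of_injective m hxy]

namespace GrAlg

theorem of_mul (A : GrAlg k) {m n : ℕ} (x : A.deg m) (y : A.deg n) :
    DirectSum.of A.deg (m + n) (A.mul x y) = DirectSum.of A.deg m x * DirectSum.of A.deg n y :=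
  (DirectSum.of_mul_of x y).symm

/-- The `S`-trivial operad `P` of a commutative graded algebra `A`: `P(n + 1) = A_n` with the
trivial action, and `x ∘ᵢ y = x y` for all `i`. -/
abbrev toOperad (A : GrAlg k) (hA : isComm k A) : Operad k where
  ops := A.deg
  act _ := LinearMap.id
  one := A.one
  comp _ := A.mul
  act_one _ := rfl
  act_mul _ _ _ := rfl
  comp_one _ := A.mul_one
  one_comp := A.one_mul
  comp_assoc _ _ := A.mul_assoc
  comp_comm _ _ _ x y z := sigma_ext_of (by omega) (by
    rw [of_mul, of_mul, of_mul, of_mul, _root_.mul_assoc, _root_.mul_assoc,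
      hA (DirectSum.of A.deg _ y)])
  comp_act _ _ _ _ := rfl
  act_comp _ _ _ _ := rfl

end GrAlg

variable (k) in
/-- The functor `G_Str` from commutative graded algebras to `S`-trivial operads. -/
def GStr : (GrAlg.isComm k).FullSubcategory ⥤ (Operad.isSTrivial k).FullSubcategory where
  obj A := ⟨A.obj.toOperad A.property, fun _ _ _ => rfl⟩
  map f := ObjectProperty.homMk
    { app := f.hom.app
      map_one := f.hom.map_one
      map_act := fun _ _ => rfl
      map_comp := fun _ => f.hom.map_mul }

namespace TypedGrAlg

variable {A B : TypedGrAlg k}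

/-- For `u = ±1`: the linear map on `A_n` that is the identity on `A_0` and on `A_{n,e}`, and the
multiplication by `u` on `A_{n,o}`. -/
def twist (hA : A.IsPGC) {n : ℕ} (u : ℤˣ) : A.deg n →ₗ[k] A.deg n :=
  if h : n = 0 then LinearMap.id
  else LinearMap.ofIsCompl (hA.isCompl n h) (A.even n).subtype (((u : ℤ) : k) • (A.odd n).subtype)

theorem twist_zero (hA : A.IsPGC) {n : ℕ} (h : n = 0) (u : ℤˣ) (x : A.deg n) :
    twist hA u x = x := by
  rw [twist, dif_pos h, LinearMap.id_apply]

theorem twist_even (hA : A.IsPGC) {n : ℕ} (u : ℤˣ) {x : A.deg n} (hx : x ∈ A.even n) :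
    twist hA u x = x := by
  by_cases h : n = 0
  · exact twist_zero hA h u x
  · rw [twist, dif_neg h]
    exact LinearMap.ofIsCompl_apply_left (hA.isCompl n h) ⟨x, hx⟩

theorem twist_odd (hA : A.IsPGC) {n : ℕ} (u : ℤˣ) {x : A.deg n} (hx : x ∈ A.odd n) :
    twist hA u x = ((u : ℤ) : k) • x := by
  by_cases h : n = 0
  · subst h
    rw [A.odd_zero, Submodule.mem_bot] at hx
    rw [hx, map_zero, smul_zero]
  · rw [twist, dif_neg h]
    exact LinearMap.ofIsCompl_apply_right (hA.isCompl n h) ⟨x, hx⟩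

theorem exists_even_add_odd (hA : A.IsPGC) {n : ℕ} (h : n ≠ 0) (x : A.deg n) :
    ∃ e ∈ A.even n, ∃ o ∈ A.odd n, e + o = x := by
  have : x ∈ A.even n ⊔ A.odd n := by
    rw [(hA.isCompl n h).sup_eq_top]; trivial
  exact Submodule.mem_sup.1 this

theorem twist_one (hA : A.IsPGC) {n : ℕ} (x : A.deg n) : twist hA 1 x = x := by
  by_cases h : n = 0
  · exact twist_zero hA h _ x
  · obtain ⟨e, he, o, ho, rfl⟩ := exists_even_add_odd hA h x
    rw [map_add, twist_even hA _ he, twist_odd hA _ ho]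
    simp

theorem twist_twist (hA : A.IsPGC) {n : ℕ} (u v : ℤˣ) (x : A.deg n) :
    twist hA u (twist hA v x) = twist hA (u * v) x := by
  by_cases h : n = 0
  · simp only [twist_zero hA h]
  · obtain ⟨e, he, o, ho, rfl⟩ := exists_even_add_odd hA h x
    simp only [map_add, map_smul, twist_even hA _ he, twist_odd hA _ ho, smul_smul]
    rw [Units.val_mul, Int.cast_mul, mul_comm]

theorem twist_mul_left (hA : A.IsPGC) {m n : ℕ} (hm : m ≠ 0) (u : ℤˣ) (x : A.deg m)
    (y : A.deg n) : A.mul (twist hA u x) y = twist hA u (A.mul x y) := by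
  obtain ⟨e, he, o, ho, rfl⟩ := exists_even_add_odd hA hm x
  simp only [map_add, map_smul, LinearMap.add_apply, LinearMap.smul_apply, twist_even hA _ he,
    twist_odd hA _ ho, twist_even hA _ (hA.even_mul e he y), twist_odd hA _ (hA.odd_mul o ho y)]

theorem twist_mul_right (hA : A.IsPGC) {m n : ℕ} (hn : n ≠ 0) (u : ℤˣ) (x : A.deg m)
    (y : A.deg n) : A.mul x (twist hA u y) = twist hA u (A.mul x y) := by
  obtain ⟨e, he, o, ho, rfl⟩ := exists_even_add_odd hA hn y
  simp only [map_add, map_smul, twist_even hA _ he,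
    twist_odd hA _ ho, twist_even hA _ (hA.mul_even x e he), twist_odd hA _ (hA.mul_odd x o ho)]

theorem even_mul_odd (hA : A.IsPGC) {m n : ℕ} {x : A.deg m} (hx : x ∈ A.even m) {y : A.deg n}
    (hy : y ∈ A.odd n) : A.mul x y = 0 := by
  by_cases h : m + n = 0
  · have hm : m = 0 := by omega
    subst hm
    rw [A.even_zero, Submodule.mem_bot] at hx
    rw [hx, map_zero, LinearMap.zero_apply]
  · exact Submodule.disjoint_def.1 (hA.isCompl _ h).disjoint _ (hA.even_mul x hx y)
      (hA.mul_odd x y hy)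

theorem odd_mul_even (hA : A.IsPGC) {m n : ℕ} {x : A.deg m} (hx : x ∈ A.odd m) {y : A.deg n}
    (hy : y ∈ A.even n) : A.mul x y = 0 := by
  by_cases h : m + n = 0
  · have hm : m = 0 := by omega
    subst hm
    rw [A.odd_zero, Submodule.mem_bot] at hx
    rw [hx, map_zero, LinearMap.zero_apply]
  · exact Submodule.disjoint_def.1 (hA.isCompl _ h).disjoint _ (hA.mul_even x y hy)
      (hA.odd_mul x hx y)

theorem of_mul_comm (hA : A.IsPGC) {m n : ℕ} (x : A.deg m) (y : A.deg n) :
    DirectSum.of A.deg m x * DirectSum.of A.deg n y =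
      DirectSum.of A.deg n (twist hA ((-1) ^ (m * n)) y) * DirectSum.of A.deg m x := by
  have hee : ∀ {m n : ℕ} (x : A.deg m) (y : A.deg n), (m = 0 ∨ x ∈ A.even m) →
      (n = 0 ∨ y ∈ A.even n) → DirectSum.of A.deg m x * DirectSum.of A.deg n y =
      DirectSum.of A.deg n y * DirectSum.of A.deg m x := by
    intro m n x y hx hy
    simpa using hA.comm x y (Or.inl ⟨rfl, hx⟩) (Or.inl ⟨rfl, hy⟩)
  have heo : ∀ {m n : ℕ} (x : A.deg m) (y : A.deg n), (m = 0 ∨ x ∈ A.even m) →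
      y ∈ A.odd n → DirectSum.of A.deg m x * DirectSum.of A.deg n y =
      DirectSum.of A.deg n y * DirectSum.of A.deg m x := by
    intro m n x y hx hy
    simpa using hA.comm x y (Or.inl ⟨rfl, hx⟩) (Or.inr ⟨rfl, hy⟩)
  have h₀ : ∀ {m n : ℕ} (x : A.deg m) (y : A.deg n), m = 0 →
      DirectSum.of A.deg m x * DirectSum.of A.deg n y =
      DirectSum.of A.deg n y * DirectSum.of A.deg m x := by
    intro m n x y hm
    by_cases hn : n = 0
    · exact hee x y (Or.inl hm) (Or.inl hn)
    · obtain ⟨e, he, o, ho, rfl⟩ := exists_even_add_odd hA hn y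
      rw [map_add, mul_add, add_mul, hee x e (Or.inl hm) (Or.inr he), heo x o (Or.inl hm) ho]
  by_cases hm : m = 0
  · have h : (-1 : ℤˣ) ^ (m * n) = 1 := by rw [hm, zero_mul, pow_zero]
    rw [h₀ x y hm, h, twist_one]
  by_cases hn : n = 0
  · rw [twist_zero hA hn, h₀ y x hn]
  obtain ⟨e, he, o, ho, rfl⟩ := exists_even_add_odd hA hm x
  obtain ⟨e', he', o', ho', rfl⟩ := exists_even_add_odd hA hn y
  have hoo : DirectSum.of A.deg m o * DirectSum.of A.deg n o' =
      DirectSum.of A.deg n (((((-1) ^ (m * n) : ℤˣ) : ℤ) : k) • o') * DirectSum.of A.deg m o := by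
    have := hA.comm o o' (Or.inr ⟨rfl, ho⟩) (Or.inr ⟨rfl, ho'⟩)
    rw [this, mul_one, mul_one]
    rcases neg_one_pow_eq_or ℤˣ (m * n) with h | h
    · have h' : ((-1) ^ (m * n) : A.Total) = 1 := by
        have := congrArg (fun u : ℤˣ => (((u : ℤ) : A.Total))) h
        simpa using this
      rw [h, h']; simp
    · have h' : ((-1) ^ (m * n) : A.Total) = -1 := by
        have := congrArg (fun u : ℤˣ => (((u : ℤ) : A.Total))) h
        simpa using this
      rw [h, h']; simp
  have h₁ : DirectSum.of A.deg m e * DirectSum.of A.deg n o' = 0 := by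
    rw [← GrAlg.of_mul, even_mul_odd hA he ho', map_zero]
  have h₂ : DirectSum.of A.deg m o * DirectSum.of A.deg n e' = 0 := by
    rw [← GrAlg.of_mul, odd_mul_even hA ho he', map_zero]
  have h₃ : DirectSum.of A.deg n e' * DirectSum.of A.deg m o = 0 := by
    rw [← GrAlg.of_mul, even_mul_odd hA he' ho, map_zero]
  have h₄ : ∀ c : k, DirectSum.of A.deg n (c • o') * DirectSum.of A.deg m e = 0 := by
    intro c
    rw [← GrAlg.of_mul, odd_mul_even hA ((A.odd n).smul_mem c ho') he, map_zero]
  simp only [map_add, twist_even hA _ he', twist_odd hA _ ho', mul_add, add_mul, h₁, h₂, h₃, h₄,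
    hoo, hee e e' (Or.inr he) (Or.inr he'), add_zero, zero_add]

theorem Hom.map_twist (f : Hom A B) (hA : A.IsPGC) (hB : B.IsPGC) {n : ℕ} (u : ℤˣ)
    (x : A.deg n) : f.app n (twist hA u x) = twist hB u (f.app n x) := by
  by_cases h : n = 0
  · rw [twist_zero hA h, twist_zero hB h]
  · obtain ⟨e, he, o, ho, rfl⟩ := exists_even_add_odd hA h x
    simp only [map_add, map_smul, twist_even hA _ he, twist_odd hA _ ho,
      twist_even hB _ (f.map_even n e he), twist_odd hB _ (f.map_odd n o ho)]

/-- The `A`-trivial operad `P` of a PGC algebra `A`: `P(n + 1) = A_n`; for `n ≥ 1` the symmetric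
group acts trivially on `A_{n,e}` and by the sign on `A_{n,o}`; and `x ∘ᵢ y` (with `i` counted
from zero) is `x y` if `x` lies in `A_0` or `A_e`, and `(-1)^{i deg(y)} x y` if `x` lies
in `A_o`. -/
abbrev toOperad (A : TypedGrAlg k) (hA : A.IsPGC) : Operad k where
  ops := A.deg
  act σ := twist hA (Equiv.Perm.sign σ)
  one := A.one
  comp {m n} i := A.mul ∘ₗ twist hA ((-1) ^ (i.1 * n))
  act_one x := by rw [Equiv.Perm.sign_one, twist_one]
  act_mul σ τ x := by rw [twist_twist, Equiv.Perm.sign_mul, mul_comm]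
  comp_one i x := by
    rw [LinearMap.comp_apply, mul_zero, pow_zero, twist_one]
    exact A.mul_one x
  one_comp x := by
    rw [LinearMap.comp_apply, twist_zero hA rfl]
    exact A.one_mul x
  comp_assoc {l m n} i j x y z := sigma_ext_of (by omega) (by
    simp only [LinearMap.comp_apply, GrAlg.of_mul]
    by_cases hm : m = 0
    · have hj : j.1 = 0 := by omega
      by_cases hl : l = 0
      · have hi : i.1 = 0 := by omega
        simp only [hi, hj, zero_mul, add_zero, pow_zero, twist_one, GrAlg.of_mul, mul_assoc]
      · simp only [hj, add_zero, zero_mul, pow_zero, twist_one, ← twist_mul_left hA hl,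
          GrAlg.of_mul, mul_assoc, twist_twist]
        rw [← pow_add]
        simp only [hm, mul_zero, add_zero, zero_add]
    · rw [← twist_mul_right hA hm, GrAlg.of_mul, mul_assoc]
      by_cases hl : l = 0
      · have hi : i.1 = 0 := by omega
        simp only [hi, zero_mul, pow_zero, zero_add, twist_one]
      · rw [← GrAlg.of_mul, ← GrAlg.of_mul, ← GrAlg.of_mul, ← GrAlg.of_mul,
          twist_mul_left hA hm, twist_mul_left hA hm,
          twist_mul_right hA (by omega), twist_mul_right hA (by omega),
          ← twist_mul_left hA hl, ← twist_mul_left hA hl, twist_twist, twist_twist,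
          ← pow_add, ← pow_add]
        congr 5
        ring_nf)
  comp_comm {l m n} i j hij x y z := sigma_ext_of (by omega) (by
    have hl : l ≠ 0 := by have := j.2; have := Fin.lt_def.1 hij; omega
    simp only [LinearMap.comp_apply, ← twist_mul_left hA hl, twist_twist, ← pow_add,
      GrAlg.of_mul]
    rw [mul_assoc, mul_assoc, of_mul_comm hA z y]
    by_cases hm : m = 0
    · rw [twist_zero hA hm]
      simp only [hm, mul_zero, add_zero, zero_add]
    · rw [← mul_assoc (DirectSum.of A.deg l _) (DirectSum.of A.deg m (twist hA _ y)),
        ← GrAlg.of_mul _ _ (twist hA _ y), twist_mul_right hA hm, ← twist_mul_left hA hl,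
        twist_twist, ← pow_add, GrAlg.of_mul, mul_assoc]
      congr 4
      ring_nf)
  comp_act {m n} i σ x y := by
    rw [sign_blockInner, LinearMap.comp_apply]
    by_cases hn : n = 0
    · have : σ = 1 := Equiv.ext fun a => Fin.ext (by omega)
      rw [this, Equiv.Perm.sign_one, twist_one, twist_one]
    · rw [twist_mul_right hA hn]
  act_comp {m n} i φ x y := by
    rw [sign_blockOuter, LinearMap.comp_apply, LinearMap.comp_apply]
    by_cases hm : m = 0
    · have h₁ : φ = 1 := Equiv.ext fun a => Fin.ext (by omega)
      have h₂ : i.1 = 0 := by omega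
      have h₃ : (φ i).1 = 0 := by omega
      rw [h₂, h₃, h₁]
      simp [twist_one]
    · rw [← twist_mul_left hA hm, twist_twist, twist_twist]
      have h : ((-1 : ℤˣ) ^ ((φ i).1 * n)) * (-1) ^ ((φ i).1 * n) = 1 := by
        rw [← mul_pow]; simp
      have h' : ((-1 : ℤˣ) ^ (i.1 * n)) * Equiv.Perm.sign φ =
          Equiv.Perm.sign φ * (-1) ^ ((i.1 + (φ i).1) * n) * (-1) ^ ((φ i).1 * n) := by
        rw [add_mul, pow_add, mul_assoc, mul_assoc, h, mul_one, mul_comm]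
      rw [h']

end TypedGrAlg

variable (k) in
/-- The functor `G_Atr` from PGC algebras to `A`-trivial operads. -/
def GAtr : (TypedGrAlg.isPGC k).FullSubcategory ⥤ (Operad.isATrivial k).FullSubcategory where
  obj A := ⟨A.obj.toOperad A.property, fun _ _ hσ x =>
    (congrArg (fun u => TypedGrAlg.twist A.property u x)
      (Equiv.Perm.mem_alternatingGroup.1 hσ)).trans (TypedGrAlg.twist_one A.property x)⟩
  map {A B} f := ObjectProperty.homMk
    { app := f.hom.app
      map_one := f.hom.map_one
      map_act := fun _ x => f.hom.map_twist A.property B.property _ x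
      map_comp := fun _ x y => (f.hom.map_mul _ y).trans
        (congrArg (fun z => B.obj.mul z _) (f.hom.map_twist A.property B.property _ x)) }

/-! ### Restriction to an equivalence -/

/-- Let `P` be a property of the objects of `C`, let `G` be a functor from the full subcategory of
the objects with `P` to `D` and let `F : D ⥤ C`.  The functors `(G, F)` restrict to an equivalence
between the objects of `C` with `X` and the objects of `D` with `Y`: the objects with `X` have `P`,
`G` maps them to objects with `Y`, `F` maps objects with `Y` to objects with `X`, and the two
restrictions are the functors of an equivalence of the full subcategories. -/
def RestrictToEquivalence {C D : Type*} [Category C] [Category D] {P : ObjectProperty C}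
    (G : P.FullSubcategory ⥤ D) (F : D ⥤ C) (X : ObjectProperty C) (Y : ObjectProperty D) : Prop :=
  ∃ (hX : X ≤ P)
    (hG : ∀ A : X.FullSubcategory, Y ((ObjectProperty.ιOfLE hX ⋙ G).obj A))
    (hF : ∀ B : Y.FullSubcategory, X ((Y.ι ⋙ F).obj B))
    (e : X.FullSubcategory ≌ Y.FullSubcategory),
    e.functor = Y.lift (ObjectProperty.ιOfLE hX ⋙ G) hG ∧ e.inverse = X.lift (Y.ι ⋙ F) hF

end GradedOperads

open GradedOperads

/-! On an operad with trivial alternating actions all odd permutations of a given arity act by one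
and the same involution (`Operad.signAct`). If the operad is also left torsionfree, the composition
at the first input determines the others. With inputs counted from zero and `x` of positive degree,
`x ∘ᵢ y` is `x ∘₀ y` with the involution applied `i * deg y` times (`comp_eq_signAct`). Inserting
`x` and `y` into two inputs of a third operation shows that `x ∘₀ y` is `y ∘₀ x` with the involution
applied `deg x * deg y` times (`comp_zero_comm`). Such identities are first seen after composing
with operations of higher arity; torsionfreeness brings them back. When `2 ≠ 0`, the involution
splits each component of positive degree into its eigenspaces for `1` and `-1`. These are the even
and odd parts, the algebra is PGC (`isPGC_toTypedGrAlg`), and the operad can be rebuilt from it. If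
the symmetric groups act trivially, the involution is the identity and no splitting is needed, so
the characteristic plays no role.

The remaining properties are transported by `Comparison`, a linear dictionary between an operad and
an algebra with twisting operators: the identity for `S`-trivial operads, `twist` for PGC algebras.
It matches torsionfreeness, dimension, truncations and homomorphisms. Saturation needs one more
point: the competing operad is only known to be left torsionfree and to agree with the given one in
high arities. Triviality of the action there descends to all arities (`isATrivial_of_trunc_iso`,
`isSTrivial_of_trunc_iso`), and so does commutativity of a competing algebra
(`isComm_of_trunc_iso`). A competing PGC algebra is PGC by definition.

For primeness, ideals of operads are graded and stable under the involution, while ideals of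
algebras need be neither. Leading components reduce the question to graded ideals
(`GrAlg.isPrime_iff`). Since `A_e A_o = 0`, a prime operad leaves only one of the two types
(`even_eq_bot_or_odd_eq_bot`), so the twist is a sign in each positive degree and preserves every
subspace. -/

namespace GradedOperads

/-- Three letters are needed: with two, the image of `i` already determines the sign. -/
theorem exists_perm_sign_eq {m : ℕ} (hm : 2 ≤ m) (i j : Fin (m + 1)) (u : ℤˣ) :
    ∃ φ : Equiv.Perm (Fin (m + 1)), Equiv.Perm.sign φ = u ∧ φ i = j := by
  obtain ⟨a, ha⟩ : ∃ a : Fin (m + 1), a ≠ i :=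
    Fintype.exists_ne_of_one_lt_card (by simp; omega) i
  obtain ⟨b, hbi, hba⟩ : ∃ b : Fin (m + 1), b ≠ i ∧ b ≠ a := by
    have := Finset.exists_mem_notMem_of_card_lt_card (s := ({i, a} : Finset (Fin (m + 1))))
      (t := Finset.univ) (lt_of_le_of_lt Finset.card_le_two (by simp; omega))
    obtain ⟨b, -, hb⟩ := this
    exact ⟨b, by simpa using hb⟩
  by_cases h : Equiv.Perm.sign (Equiv.swap i j) = u
  · exact ⟨_, h, Equiv.swap_apply_left i j⟩
  -- The extra transposition avoids `i`, so it reverses the sign and leaves the image of `i`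
  -- unchanged.
  · refine ⟨Equiv.swap i j * Equiv.swap a b, ?_, ?_⟩
    · rw [Equiv.Perm.sign_mul, Equiv.Perm.sign_swap hba.symm]
      rcases Int.units_eq_one_or (Equiv.Perm.sign (Equiv.swap i j)) with h₁ | h₁ <;>
        rcases Int.units_eq_one_or u with h₂ | h₂ <;> simp_all
    · rw [Equiv.Perm.mul_apply, Equiv.swap_apply_of_ne_of_ne ha.symm hbi.symm,
        Equiv.swap_apply_left]

theorem sign_swap_zero_last {n : ℕ} (hn : n ≠ 0) :
    Equiv.Perm.sign (Equiv.swap (0 : Fin (n + 1)) (Fin.last n)) = -1 :=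
  Equiv.Perm.sign_swap fun h => hn (by simpa using (congrArg Fin.val h).symm)

theorem perm_fin_one_eq_one (σ : Equiv.Perm (Fin (0 + 1))) : σ = 1 :=
  Equiv.ext fun i => Fin.ext (by omega)

variable {k : Type u} [Field k]

/-! ### Identities between homogeneous elements in propositionally equal degrees -/

theorem of_eq_of_sigma_eq {A : ℕ → Type u} [∀ n, AddCommGroup (A n)] {m n : ℕ} {x : A m} {y : A n}
    (h : (⟨m, x⟩ : Σ n, A n) = ⟨n, y⟩) : DirectSum.of A m x = DirectSum.of A n y := by
  cases h
  rfl

theorem GrAlg.isComm_of_homogeneous (A : GrAlg k) (h : ∀ {m n : ℕ} (x : A.deg m) (y : A.deg n),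
    (⟨m + n, A.mul x y⟩ : Σ n, A.deg n) = ⟨n + m, A.mul y x⟩) : GrAlg.isComm k A := by
  intro x y
  induction x using DirectSum.induction_on with
  | zero => rw [zero_mul, mul_zero]
  | add x x' hx hx' => rw [add_mul, mul_add, hx, hx']
  | of m x =>
    induction y using DirectSum.induction_on with
    | zero => rw [zero_mul, mul_zero]
    | add y y' hy hy' => rw [add_mul, mul_add, hy, hy']
    | of n y =>
      rw [← GrAlg.of_mul, ← GrAlg.of_mul]
      exact of_eq_of_sigma_eq (h x y)

theorem GrAlg.of_mul_of_eq_neg_one_pow (A : GrAlg k) {m n : ℕ} (e : ℕ) (x : A.deg m) (y : A.deg n)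
    (h : (⟨m + n, A.mul x y⟩ : Σ n, A.deg n) = ⟨n + m, (-1 : k) ^ e • A.mul y x⟩) :
    DirectSum.of A.deg m x * DirectSum.of A.deg n y =
      (-1) ^ e * (DirectSum.of A.deg n y * DirectSum.of A.deg m x) := by
  rw [← GrAlg.of_mul, ← GrAlg.of_mul, of_eq_of_sigma_eq h]
  rcases Nat.even_or_odd e with he | he <;> simp [he.neg_one_pow]

/-! ### The sign involution on operads with trivial alternating actions -/

namespace Operad

variable {P : Operad k}

/-- Torsionfreeness as a cancellation rule. Identities known only after composition with large
operations are lowered to all arities in this way. -/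
theorem LeftTorsionfree.sigma_ext (hP : P.LeftTorsionfree) {a b : ℕ} {x : P.ops a} {y : P.ops b}
    (hab : a = b) (N : ℕ) (h : ∀ n, N ≤ n → ∀ (i : Fin (n + 1)) (z : P.ops n),
      (⟨n + a, P.comp i z x⟩ : Σ n, P.ops n) = ⟨n + b, P.comp i z y⟩) :
    (⟨a, x⟩ : Σ n, P.ops n) = ⟨b, y⟩ := by
  subst hab
  have : x - y = 0 := hP a _ ⟨N, fun n hn i z => by
    rw [map_sub, sub_eq_zero]
    exact eq_of_heq (Sigma.mk.inj (h n hn i z)).2⟩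
  rw [sub_eq_zero.1 this]

/-- The action of an odd permutation if `u = -1`, and the identity if `u = 1`. -/
def signAct (P : Operad k) {n : ℕ} (u : ℤˣ) : P.ops n →ₗ[k] P.ops n :=
  if u = 1 then LinearMap.id else P.act (Equiv.swap 0 (Fin.last n))

theorem signAct_one {n : ℕ} (x : P.ops n) : P.signAct 1 x = x := by
  rw [signAct, if_pos rfl, LinearMap.id_apply]

theorem signAct_neg_one {n : ℕ} (x : P.ops n) :
    P.signAct (-1) x = P.act (Equiv.swap 0 (Fin.last n)) x := by
  rw [signAct, if_neg (by decide)]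

theorem signAct_degree_zero (u : ℤˣ) (x : P.ops 0) : P.signAct u x = x := by
  rcases Int.units_eq_one_or u with rfl | rfl
  · exact signAct_one x
  · rw [signAct_neg_one, perm_fin_one_eq_one (Equiv.swap _ _), P.act_one]

theorem signAct_signAct {n : ℕ} (u v : ℤˣ) (x : P.ops n) :
    P.signAct u (P.signAct v x) = P.signAct (u * v) x := by
  rcases Int.units_eq_one_or u with rfl | rfl
  · rw [signAct_one, one_mul]
  rcases Int.units_eq_one_or v with rfl | rfl
  · rw [signAct_one, mul_one]
  · rw [signAct_neg_one, signAct_neg_one, ← P.act_mul, Equiv.swap_mul_self, P.act_one,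
      neg_mul_neg, one_mul, signAct_one]

theorem signAct_congr {m m' : ℕ} {x : P.ops m} {x' : P.ops m'} (u : ℤˣ)
    (hx : (⟨m, x⟩ : Σ n, P.ops n) = ⟨m', x'⟩) :
    (⟨m, P.signAct u x⟩ : Σ n, P.ops n) = ⟨m', P.signAct u x'⟩ := by
  cases hx
  rfl

theorem act_eq_signAct (hP : isATrivial k P) {n : ℕ} (σ : Equiv.Perm (Fin (n + 1))) (x : P.ops n) :
    P.act σ x = P.signAct (Equiv.Perm.sign σ) x := by
  by_cases hn : n = 0
  · subst hn
    rw [signAct_degree_zero, perm_fin_one_eq_one σ, P.act_one]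
  rcases Int.units_eq_one_or (Equiv.Perm.sign σ) with h | h
  · rw [h, signAct_one]
    exact hP n σ (Equiv.Perm.mem_alternatingGroup.2 h) x
  · rw [h, signAct_neg_one]
    -- For a right action the left factor acts first; the remaining factor is even and acts
    -- trivially.
    have : σ = Equiv.swap 0 (Fin.last n) * (Equiv.swap 0 (Fin.last n) * σ) := by
      rw [← mul_assoc, Equiv.swap_mul_self, one_mul]
    rw [this, P.act_mul]
    refine hP n _ (Equiv.Perm.mem_alternatingGroup.2 ?_) _
    rw [Equiv.Perm.sign_mul, h, sign_swap_zero_last hn, neg_mul_neg, one_mul]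

/-- Permuting the inputs inside the inserted block does not change the sign. Arity one is excluded
because it has no odd permutation, whereas the composite may have one. -/
theorem comp_signAct (hP : isATrivial k P) {m n : ℕ} (hn : n ≠ 0) (i : Fin (m + 1)) (u : ℤˣ)
    (x : P.ops m) (y : P.ops n) : P.comp i x (P.signAct u y) = P.signAct u (P.comp i x y) := by
  rcases Int.units_eq_one_or u with rfl | rfl
  · rw [signAct_one, signAct_one]
  · rw [← sign_swap_zero_last hn, ← act_eq_signAct hP, P.comp_act, act_eq_signAct hP,
      sign_blockInner]

/-- With at least three inputs, a permutation taking `i` to `j` can be chosen with sign `u`;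
equivariance and the sign of the block permutation do the rest. -/
theorem signAct_comp_of_two_le (hP : isATrivial k P) {m n : ℕ} (hm : 2 ≤ m) (i j : Fin (m + 1))
    (u : ℤˣ) (x : P.ops m) (y : P.ops n) :
    P.comp i (P.signAct u x) y =
      P.signAct (u * (-1) ^ ((i.1 + j.1) * n)) (P.comp j x y) := by
  obtain ⟨φ, rfl, rfl⟩ := exists_perm_sign_eq hm i j u
  rw [← act_eq_signAct hP, P.act_comp, act_eq_signAct hP, sign_blockOuter]

/-- This adds the case of a binary `x`, where `i` and `j` dictate the sign of the permutation.
Composing with some `z` of positive degree yields an operation with at least three inputs, and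
torsionfreeness removes `z` again. -/
theorem signAct_comp (hP : isATrivial k P) (ht : P.LeftTorsionfree) {m n : ℕ} (hm : m ≠ 0)
    (i j : Fin (m + 1)) (u : ℤˣ) (x : P.ops m) (y : P.ops n) :
    P.comp i (P.signAct u x) y =
      P.signAct (u * (-1) ^ ((i.1 + j.1) * n)) (P.comp j x y) := by
  refine eq_of_heq (Sigma.mk.inj (ht.sigma_ext rfl 1 fun l hl a z => ?_)).2
  have hlm : 2 ≤ l + m := by omega
  rw [comp_signAct hP (by omega)]
  refine (P.comp_assoc a i z (P.signAct u x) y).symm.trans ?_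
  rw [comp_signAct hP hm, signAct_comp_of_two_le hP hlm _ ⟨a.1 + j.1, by omega⟩]
  -- Both inputs are shifted by the place `a` of `x` in `z`, which changes the exponent by an even
  -- number.
  have e : (-1 : ℤˣ) ^ ((a.1 + i.1 + (a.1 + j.1)) * n) = (-1) ^ ((i.1 + j.1) * n) := by
    rw [show (a.1 + i.1 + (a.1 + j.1)) * n = 2 * (a.1 * n) + (i.1 + j.1) * n by ring, pow_add,
      pow_mul]
    simp
  simp only [e]
  exact signAct_congr _ (P.comp_assoc a j z x y)

theorem comp_eq_signAct (hP : isATrivial k P) (ht : P.LeftTorsionfree) {m n : ℕ} (hm : m ≠ 0)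
    (i j : Fin (m + 1)) (x : P.ops m) (y : P.ops n) :
    P.comp i x y = P.signAct ((-1) ^ ((i.1 + j.1) * n)) (P.comp j x y) := by
  have := signAct_comp hP ht hm i j 1 x y
  rwa [signAct_one, one_mul] at this

theorem signAct_comp_zero (hP : isATrivial k P) (ht : P.LeftTorsionfree) {m n : ℕ} (hm : m ≠ 0)
    (u : ℤˣ) (x : P.ops m) (y : P.ops n) :
    P.comp 0 (P.signAct u x) y = P.signAct u (P.comp 0 x y) := by
  have := signAct_comp hP ht hm 0 0 u x y
  rwa [Fin.val_zero, add_zero, zero_mul, pow_zero, mul_one] at this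

theorem LeftTorsionfree.sigma_ext_zero (ht : P.LeftTorsionfree) (hP : isATrivial k P) {a b : ℕ}
    {x : P.ops a} {y : P.ops b} (hab : a = b) (N : ℕ) (h : ∀ n, N ≤ n → ∀ z : P.ops n,
      (⟨n + a, P.comp 0 z x⟩ : Σ n, P.ops n) = ⟨n + b, P.comp 0 z y⟩) :
    (⟨a, x⟩ : Σ n, P.ops n) = ⟨b, y⟩ := by
  subst hab
  -- The bound `N + 1` forces positive degree on `z`, as required for moving from input `i` to input
  -- `0`.
  refine ht.sigma_ext rfl (N + 1) fun n hn i z => ?_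
  rw [comp_eq_signAct hP ht (by omega) i 0, comp_eq_signAct hP ht (by omega) i 0]
  exact signAct_congr _ (h n (by omega) z)

/-- Parallel insertion is the source of commutativity: `x` and `y` go into inputs `0` and `1` of a
test operation `z` in either order. Moving both compositions back to input `0` costs the exponents
`(1 + m) * n` and `n`, whose sum has the parity of `m * n`. -/
theorem comp_zero_comm (hP : isATrivial k P) (ht : P.LeftTorsionfree) {m n : ℕ} (x : P.ops m)
    (y : P.ops n) : (⟨m + n, P.comp 0 x y⟩ : Σ n, P.ops n) =
      ⟨n + m, P.signAct ((-1) ^ (m * n)) (P.comp 0 y x)⟩ := by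
  refine ht.sigma_ext_zero hP (by omega) 1 fun l hl z => ?_
  have hl₀ : l ≠ 0 := by omega
  have h₁ : (⟨l + (m + n), P.comp 0 z (P.comp 0 x y)⟩ : Σ n, P.ops n) =
      ⟨l + m + n, P.comp 0 (P.comp 0 z x) y⟩ := (P.comp_assoc 0 0 z x y).symm
  have h₂ : (⟨l + (n + m), P.comp 0 z (P.comp 0 y x)⟩ : Σ n, P.ops n) =
      ⟨l + n + m, P.comp 0 (P.comp 0 z y) x⟩ := (P.comp_assoc 0 0 z y x).symm
  -- After `x` fills input `0` of `z`, the former input `1` has number `1 + m`.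
  have h₃ := P.comp_comm (m := m) (n := n) (⟨0, by omega⟩ : Fin (l + 1)) ⟨1, by omega⟩
    (by simp [Fin.lt_def]) z x y
  have h₄ : P.comp 0 z (P.signAct ((-1) ^ (m * n)) (P.comp 0 y x)) =
      P.signAct ((-1) ^ (m * n)) (P.comp 0 z (P.comp 0 y x)) := by
    by_cases h : n + m = 0
    · have : m * n = 0 := by rw [show m = 0 by omega, zero_mul]
      rw [this, pow_zero, signAct_one, signAct_one]
    · exact comp_signAct hP h _ _ _ _
  rw [h₁, h₄, comp_eq_signAct hP ht (by omega) 0 ⟨1 + m, by omega⟩]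
  refine (signAct_congr _ h₃).trans ?_
  rw [comp_eq_signAct hP ht hl₀ ⟨1, _⟩ 0 z y]
  refine Eq.trans ?_ (signAct_congr _ h₂).symm
  have h₅ := signAct_comp_zero hP ht (by omega) ((-1) ^ (1 * n)) (P.comp 0 z y) x
  have e : (-1 : ℤˣ) ^ ((1 + m) * n) * (-1) ^ (1 * n) = (-1) ^ (m * n) := by
    rw [← pow_add, show (1 + m) * n + 1 * n = 2 * n + m * n by ring, pow_add, pow_mul]
    simp
  change (⟨_, P.signAct _ (P.comp 0 (P.signAct ((-1) ^ ((1 + 0) * n)) (P.comp 0 z y)) x)⟩ :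
    Σ n, P.ops n) = _
  simp only [add_zero, Fin.val_zero, zero_add, h₅, signAct_signAct, e]

/-! ### Even and odd operations -/

theorem mem_evenOps_iff (hP : isATrivial k P) {n : ℕ} (hn : n ≠ 0) {x : P.ops n} :
    x ∈ P.evenOps n ↔ P.signAct (-1) x = x := by
  obtain ⟨n, rfl⟩ := Nat.exists_eq_succ_of_ne_zero hn
  refine ⟨fun h => (signAct_neg_one x).trans (h _), fun h σ => ?_⟩
  rw [act_eq_signAct hP]
  rcases Int.units_eq_one_or (Equiv.Perm.sign σ) with h' | h' <;> rw [h']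
  · exact signAct_one x
  · exact h

theorem mem_oddOps_iff (hP : isATrivial k P) {n : ℕ} (hn : n ≠ 0) {x : P.ops n} :
    x ∈ P.oddOps n ↔ P.signAct (-1) x = -x := by
  obtain ⟨n, rfl⟩ := Nat.exists_eq_succ_of_ne_zero hn
  refine ⟨fun h => ?_, fun h σ => ?_⟩
  · rw [signAct_neg_one, h, sign_swap_zero_last hn]
    simp
  · rw [act_eq_signAct hP]
    rcases Int.units_eq_one_or (Equiv.Perm.sign σ) with h' | h' <;> rw [h']
    · rw [signAct_one]; simp
    · rw [h]; simp

theorem signAct_of_mem_evenOps (hP : isATrivial k P) {n : ℕ} (u : ℤˣ) {x : P.ops n}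
    (hx : x ∈ P.evenOps n) : P.signAct u x = x := by
  by_cases hn : n = 0
  · subst hn; exact signAct_degree_zero u x
  rcases Int.units_eq_one_or u with rfl | rfl
  · exact signAct_one x
  · exact (mem_evenOps_iff hP hn).1 hx

theorem signAct_of_mem_oddOps (hP : isATrivial k P) {n : ℕ} (u : ℤˣ) {x : P.ops n}
    (hx : x ∈ P.oddOps n) : P.signAct u x = ((u : ℤ) : k) • x := by
  by_cases hn : n = 0
  · subst hn
    rw [show x = 0 from hx, map_zero, smul_zero]
  rcases Int.units_eq_one_or u with rfl | rfl
  · rw [signAct_one]; simp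
  · rw [(mem_oddOps_iff hP hn).1 hx]; simp

/-- Eigenspace decomposition of an involution, with half of `1 ± signAct (-1)` as the projections.
-/
theorem isCompl_evenOps_oddOps (h2 : (2 : k) ≠ 0) (hP : isATrivial k P) {n : ℕ} (hn : n ≠ 0) :
    IsCompl (P.evenOps n) (P.oddOps n) := by
  constructor
  · refine Submodule.disjoint_def.2 fun x he ho => ?_
    rw [mem_evenOps_iff hP hn] at he
    rw [mem_oddOps_iff hP hn, he, eq_neg_iff_add_eq_zero, ← two_smul k] at ho
    exact (smul_eq_zero.1 ho).resolve_left h2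
  · refine codisjoint_iff.2 (eq_top_iff.2 fun x _ => Submodule.mem_sup.2
      ⟨(2 : k)⁻¹ • (x + P.signAct (-1) x), ?_, (2 : k)⁻¹ • (x - P.signAct (-1) x), ?_, ?_⟩)
    · rw [mem_evenOps_iff hP hn, map_smul, map_add, signAct_signAct, neg_mul_neg, one_mul,
        signAct_one, add_comm]
    · rw [mem_oddOps_iff hP hn, map_smul, map_sub, signAct_signAct, neg_mul_neg, one_mul,
        signAct_one, ← smul_neg, neg_sub]
    · rw [← smul_add, add_add_sub_cancel, ← two_smul k, smul_smul, inv_mul_cancel₀ h2, one_smul]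

theorem comp_mem_evenOps (hP : isATrivial k P) {m n : ℕ} (x : P.ops m) {y : P.ops n}
    (hy : y ∈ P.evenOps n) : P.comp 0 x y ∈ P.evenOps (m + n) := by
  by_cases hn : n = 0
  · subst hn
    rw [show y = 0 from hy, map_zero]; exact zero_mem _
  · rw [mem_evenOps_iff hP (by omega), ← comp_signAct hP hn, signAct_of_mem_evenOps hP _ hy]

theorem comp_mem_oddOps (hP : isATrivial k P) {m n : ℕ} (x : P.ops m) {y : P.ops n}
    (hy : y ∈ P.oddOps n) : P.comp 0 x y ∈ P.oddOps (m + n) := by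
  by_cases hn : n = 0
  · subst hn
    rw [show y = 0 from hy, map_zero]; exact zero_mem _
  · rw [mem_oddOps_iff hP (by omega), ← comp_signAct hP hn, (mem_oddOps_iff hP hn).1 hy, map_neg]

theorem evenOps_comp_mem (hP : isATrivial k P) (ht : P.LeftTorsionfree) {m n : ℕ} {x : P.ops m}
    (hx : x ∈ P.evenOps m) (y : P.ops n) : P.comp 0 x y ∈ P.evenOps (m + n) := by
  by_cases hm : m = 0
  · subst hm
    rw [show x = 0 from hx, map_zero, LinearMap.zero_apply]; exact zero_mem _
  · rw [mem_evenOps_iff hP (by omega), ← signAct_comp_zero hP ht hm,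
      signAct_of_mem_evenOps hP _ hx]

theorem oddOps_comp_mem (hP : isATrivial k P) (ht : P.LeftTorsionfree) {m n : ℕ} {x : P.ops m}
    (hx : x ∈ P.oddOps m) (y : P.ops n) : P.comp 0 x y ∈ P.oddOps (m + n) := by
  by_cases hm : m = 0
  · subst hm
    rw [show x = 0 from hx, map_zero, LinearMap.zero_apply]; exact zero_mem _
  · rw [mem_oddOps_iff hP (by omega), ← signAct_comp_zero hP ht hm,
      (mem_oddOps_iff hP hm).1 hx, map_neg, LinearMap.neg_apply]

/-- The involution passes through both factors of a product of positive degrees, so its eigenspaces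
are ideals. The commutation rule is `comp_zero_comm`: the involution is trivial on a product with an
even factor and is a scalar on a product of odd ones. -/
theorem isPGC_toTypedGrAlg (h2 : (2 : k) ≠ 0) (hP : isATrivial k P) (ht : P.LeftTorsionfree) :
    P.toTypedGrAlg.IsPGC where
  isCompl _ hn := isCompl_evenOps_oddOps h2 hP hn
  mul_even x _ hy := comp_mem_evenOps hP x hy
  even_mul _ hx y := evenOps_comp_mem hP ht hx y
  mul_odd x _ hy := comp_mem_oddOps hP x hy
  odd_mul _ hx y := oddOps_comp_mem hP ht hx y
  comm {m n s t} y z hy hz := by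
    refine P.toGrAlg.of_mul_of_eq_neg_one_pow _ y z ((comp_zero_comm hP ht y z).trans ?_)
    change (⟨_, _⟩ : Σ n, P.ops n) = ⟨_, (-1 : k) ^ (m * n * s * t) • P.comp 0 z y⟩
    rcases hy with ⟨rfl, hy⟩ | ⟨rfl, hy⟩
    · rw [mul_zero, zero_mul, pow_zero, one_smul]
      rcases hy with rfl | hy
      · rw [zero_mul, pow_zero, signAct_one]
      · rw [signAct_of_mem_evenOps hP _ (comp_mem_evenOps hP z hy)]
    rcases hz with ⟨rfl, hz⟩ | ⟨rfl, hz⟩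
    · rw [mul_zero, pow_zero, one_smul]
      rcases hz with rfl | hz
      · rw [mul_zero, pow_zero, signAct_one]
      · rw [signAct_of_mem_evenOps hP _ (evenOps_comp_mem hP ht hz y)]
    · rw [signAct_of_mem_oddOps hP _ (comp_mem_oddOps hP z hy), mul_one, mul_one]
      simp

theorem twist_toTypedGrAlg (hP : isATrivial k P) (hA : P.toTypedGrAlg.IsPGC) {n : ℕ} (u : ℤˣ)
    (x : P.ops n) : TypedGrAlg.twist hA u x = P.signAct u x := by
  by_cases hn : n = 0
  · subst hn
    rw [TypedGrAlg.twist_zero hA rfl]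
    exact (signAct_degree_zero u x).symm
  obtain ⟨e, he, o, ho, rfl⟩ := TypedGrAlg.exists_even_add_odd hA hn x
  rw [map_add, TypedGrAlg.twist_even hA u he, TypedGrAlg.twist_odd hA u ho]
  exact ((map_add _ _ _).trans (congrArg₂ _ (signAct_of_mem_evenOps hP u he)
    (signAct_of_mem_oddOps hP u ho))).symm

/-! ### `S`-trivial operads -/

/-- Equivariance for the transposition of `i` and `0` suffices; in contrast to the alternating case,
no torsionfreeness enters. -/
theorem comp_eq_comp_zero (hP : isSTrivial k P) {m n : ℕ} (i : Fin (m + 1)) (x : P.ops m)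
    (y : P.ops n) : P.comp i x y = P.comp 0 x y := by
  have := P.act_comp i (Equiv.swap i 0) x y
  rwa [hP, hP, Equiv.swap_apply_left] at this

theorem isATrivial_of_isSTrivial (hP : isSTrivial k P) : isATrivial k P :=
  fun n σ _ x => hP n σ x

theorem isComm_toGrAlg (hP : isSTrivial k P) (ht : P.LeftTorsionfree) :
    GrAlg.isComm k P.toGrAlg := by
  refine P.toGrAlg.isComm_of_homogeneous fun {m n} x y =>
    (comp_zero_comm (isATrivial_of_isSTrivial hP) ht x y).trans ?_
  change (⟨_, _⟩ : Σ n, P.ops n) = ⟨_, P.comp 0 y x⟩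
  rcases neg_one_pow_eq_or ℤˣ (m * n) with h | h <;> rw [h]
  · rw [signAct_one]
  · rw [signAct_neg_one, hP]

/-! ### Triviality of the actions in high arities -/

/-- A permutation of the inserted operation induces one of the same sign on the composite, where the
action is already known. The predicate `s` on signs treats alternating and symmetric groups
together. -/
theorem act_eq_of_forall_ge (ht : P.LeftTorsionfree) {s : ℤˣ → Prop} {w : ℕ}
    (h : ∀ n, w ≤ n → ∀ (σ : Equiv.Perm (Fin (n + 1))), s (Equiv.Perm.sign σ) →
      ∀ x : P.ops n, P.act σ x = x)
    {n : ℕ} (σ : Equiv.Perm (Fin (n + 1))) (hσ : s (Equiv.Perm.sign σ)) (x : P.ops n) :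
    P.act σ x = x := by
  refine eq_of_heq (Sigma.mk.inj (ht.sigma_ext rfl w fun l hl i z => ?_)).2
  rw [P.comp_act, h _ (by omega) _ (by rwa [sign_blockInner])]

/-- The components of an isomorphism of truncated operads in high arities transport the action. -/
theorem act_eq_of_trunc_iso {Q : Operad k} {w : ℕ} (φ : Q.trunc w ≅ P.trunc w) {n : ℕ}
    (hn : w ≤ n + 1) (hn₀ : n ≠ 0) {σ : Equiv.Perm (Fin (n + 1))}
    (h : ∀ x : P.ops n, P.act σ x = x) (x : Q.ops n) : Q.act σ x = x := by
  have hx : x ∈ Q.truncOps w n := by rw [truncOps_of_le Q hn hn₀]; trivial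
  have hinj : Function.Injective (φ.hom.app n) := fun a b hab => by
    have e : ∀ a, φ.inv.app n (φ.hom.app n a) = a := fun a =>
      congrArg (fun f : Q.trunc w ⟶ Q.trunc w => f.app n a) φ.hom_inv_id
    rw [← e a, ← e b, hab]
  have : (Q.trunc w).act σ ⟨x, hx⟩ = ⟨x, hx⟩ := hinj (by
    rw [φ.hom.map_act]
    exact Subtype.ext (h _))
  exact congrArg Subtype.val this

/-- Places the arbitrary competitor in the definition of saturation among the operads to which the
dictionary applies. -/
theorem isATrivial_of_trunc_iso (hP : isATrivial k P) {Q : Operad k} (hQ : Q.LeftTorsionfree)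
    {w : ℕ} (φ : Q.trunc w ≅ P.trunc w) : isATrivial k Q := fun n σ hσ x =>
  -- The index `w + 1` avoids degree `0`, where the truncation is only the line of the identity.
  act_eq_of_forall_ge hQ (s := fun u => u = 1) (w := w + 1)
    (fun n hn σ hσ x => act_eq_of_trunc_iso φ (by omega) (by omega)
      (hP n σ (Equiv.Perm.mem_alternatingGroup.2 hσ)) x)
    σ (Equiv.Perm.mem_alternatingGroup.1 hσ) x

theorem isSTrivial_of_trunc_iso (hP : isSTrivial k P) {Q : Operad k} (hQ : Q.LeftTorsionfree)
    {w : ℕ} (φ : Q.trunc w ≅ P.trunc w) : isSTrivial k Q := fun n σ x =>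
  act_eq_of_forall_ge hQ (s := fun _ => True) (w := w + 1)
    (fun n hn σ _ x => act_eq_of_trunc_iso φ (by omega) (by omega) (hP n σ) x)
    σ trivial x

end Operad

/-! ### Graded algebras: homogeneous components and ideals -/

namespace GrAlg

variable {A : GrAlg k}

theorem of_mul_apply_add {l : ℕ} (z : A.deg l) (x : A.Total) (n : ℕ) :
    (DirectSum.of A.deg l z * x) (l + n) = A.mul z (x n) := by
  induction x using DirectSum.induction_on with
  | zero => rw [mul_zero, DirectSum.zero_apply, DirectSum.zero_apply, map_zero]
  | add x y hx hy => rw [mul_add, DirectSum.add_apply, DirectSum.add_apply, hx, hy, map_add]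
  | of m x =>
    rw [← of_mul]
    by_cases h : m = n
    · subst h
      rw [DirectSum.of_eq_same, DirectSum.of_eq_same]
    · rw [DirectSum.of_eq_of_ne _ _ _ (by omega), DirectSum.of_eq_of_ne _ _ _ (Ne.symm h),
        map_zero]

theorem of_mul_apply_of_lt {l : ℕ} (z : A.deg l) (x : A.Total) {n : ℕ} (h : n < l) :
    (DirectSum.of A.deg l z * x) n = 0 := by
  induction x using DirectSum.induction_on with
  | zero => simp
  | add x y hx hy => rw [mul_add, DirectSum.add_apply, hx, hy, add_zero]
  | of m x => rw [← of_mul, DirectSum.of_eq_of_ne _ _ _ (by omega)]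

theorem mul_of_apply_add {l : ℕ} (z : A.deg l) (x : A.Total) (n : ℕ) :
    (x * DirectSum.of A.deg l z) (n + l) = A.mul (x n) z := by
  induction x using DirectSum.induction_on with
  | zero => simp
  | add x y hx hy =>
    rw [add_mul, DirectSum.add_apply, DirectSum.add_apply, hx, hy, map_add, LinearMap.add_apply]
  | of m x =>
    rw [← of_mul]
    by_cases h : m = n
    · subst h
      rw [DirectSum.of_eq_same, DirectSum.of_eq_same]
    · rw [DirectSum.of_eq_of_ne _ _ _ (by omega), DirectSum.of_eq_of_ne _ _ _ (Ne.symm h),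
        map_zero, LinearMap.zero_apply]

theorem mul_of_apply_of_lt {l : ℕ} (z : A.deg l) (x : A.Total) {n : ℕ} (h : n < l) :
    (x * DirectSum.of A.deg l z) n = 0 := by
  induction x using DirectSum.induction_on with
  | zero => simp
  | add x y hx hy => rw [add_mul, DirectSum.add_apply, hx, hy, add_zero]
  | of m x => rw [← of_mul, DirectSum.of_eq_of_ne _ _ _ (by omega)]

/-- Multiplication by a homogeneous element shifts degrees, so it kills an element exactly when it
kills each component. Operads have only homogeneous elements, so this is the form to compare with.
-/
theorem leftTorsionfree_iff : A.LeftTorsionfree ↔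
    ∀ (m : ℕ) (x : A.deg m), (∃ N : ℕ, ∀ n, N ≤ n → ∀ z : A.deg n, A.mul z x = 0) → x = 0 := by
  constructor
  · rintro h m x ⟨N, hN⟩
    refine (map_eq_zero_iff _ (DirectSum.of_injective m)).1 (h _ ⟨N, fun n hn z => ?_⟩)
    rw [← of_mul, hN n hn z, map_zero]
  · rintro h x ⟨N, hN⟩
    refine DFinsupp.ext fun m => h m _ ⟨N, fun n hn z => ?_⟩
    rw [← of_mul_apply_add, hN n hn z, DirectSum.zero_apply]

/-! ### Primeness in terms of graded ideals -/

/-- A graded two-sided ideal. -/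
structure GradedIdeal (A : GrAlg k) where
  carrier : ∀ n, Submodule k (A.deg n)
  mul_mem_left : ∀ {m n : ℕ} (z : A.deg m), ∀ x ∈ carrier n, A.mul z x ∈ carrier (m + n)
  mul_mem_right : ∀ {m n : ℕ}, ∀ x ∈ carrier m, ∀ z : A.deg n, A.mul x z ∈ carrier (m + n)

/-- The elements all of whose components lie in a graded ideal. -/
def GradedIdeal.total (I : GradedIdeal A) : _root_.TwoSidedIdeal A.Total :=
  TwoSidedIdeal.mk' {x | ∀ n, x n ∈ I.carrier n}
    (fun n => (I.carrier n).zero_mem)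
    (fun hx hy n => (I.carrier n).add_mem (hx n) (hy n))
    (fun hx n => (I.carrier n).neg_mem (hx n))
    (fun {z x} hx => by
      induction z using DirectSum.induction_on with
      | zero => intro n; rw [zero_mul]; exact zero_mem _
      | add y z hy hz => intro n; rw [add_mul]; exact add_mem (hy n) (hz n)
      | of l z =>
        intro n
        by_cases h : n < l
        · rw [of_mul_apply_of_lt _ _ h]; exact zero_mem _
        · obtain ⟨n, rfl⟩ := Nat.exists_eq_add_of_le (not_lt.1 h)
          rw [of_mul_apply_add]; exact I.mul_mem_left _ _ (hx n))
    (fun {x z} hx => by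
      induction z using DirectSum.induction_on with
      | zero => intro n; rw [mul_zero]; exact zero_mem _
      | add y z hy hz => intro n; rw [mul_add]; exact add_mem (hy n) (hz n)
      | of l z =>
        intro n
        by_cases h : n < l
        · rw [mul_of_apply_of_lt _ _ h]; exact zero_mem _
        · obtain ⟨n, rfl⟩ := Nat.exists_eq_add_of_le' (not_lt.1 h)
          rw [mul_of_apply_add]; exact I.mul_mem_right _ (hx n) _)

theorem GradedIdeal.mem_total {I : GradedIdeal A} {x : A.Total} :
    x ∈ I.total ↔ ∀ n, x n ∈ I.carrier n :=
  TwoSidedIdeal.mem_mk' _ _ _ _ _ _ _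

theorem GradedIdeal.of_mem_total {I : GradedIdeal A} {n : ℕ} {x : A.deg n}
    (hx : x ∈ I.carrier n) : DirectSum.of A.deg n x ∈ I.total := by
  refine mem_total.2 fun m => ?_
  by_cases h : n = m
  · subst h; rwa [DirectSum.of_eq_same]
  · rw [DirectSum.of_eq_of_ne _ _ _ (Ne.symm h)]; exact zero_mem _

theorem GradedIdeal.total_ne_bot {I : GradedIdeal A} (h : ∃ n, I.carrier n ≠ ⊥) :
    I.total ≠ ⊥ := by
  obtain ⟨n, hn⟩ := h
  obtain ⟨x, hx, hx₀⟩ := Submodule.exists_mem_ne_zero_of_ne_bot hn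
  intro h
  have := of_mem_total hx
  rw [h, TwoSidedIdeal.mem_bot] at this
  exact hx₀ ((map_eq_zero_iff _ (DirectSum.of_injective n)).1 this)

theorem smul_mem_twoSidedIdeal (I : _root_.TwoSidedIdeal A.Total) (c : k) {x : A.Total}
    (hx : x ∈ I) : c • x ∈ I := by
  rw [Algebra.smul_def]
  exact I.mul_mem_left _ _ hx

/-- The graded ideal spanned by the homogeneous components of highest degree of the elements of
an ideal. -/
def leadingIdeal (I : _root_.TwoSidedIdeal A.Total) : GradedIdeal A where
  carrier n :=
    { carrier := {a | ∃ x ∈ I, x n = a ∧ ∀ j, n < j → x j = 0}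
      add_mem' := by
        rintro _ _ ⟨x, hx, rfl, hx'⟩ ⟨y, hy, rfl, hy'⟩
        exact ⟨x + y, I.add_mem hx hy, rfl, fun j hj => by
          rw [DirectSum.add_apply, hx' j hj, hy' j hj, add_zero]⟩
      zero_mem' := ⟨0, I.zero_mem, rfl, fun _ _ => rfl⟩
      smul_mem' := by
        rintro c _ ⟨x, hx, rfl, hx'⟩
        exact ⟨c • x, smul_mem_twoSidedIdeal I c hx, rfl, fun j hj => by
          rw [DirectSum.smul_apply, hx' j hj, smul_zero]⟩ }
  mul_mem_left := by
    rintro m n z _ ⟨x, hx, rfl, hx'⟩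
    refine ⟨DirectSum.of A.deg m z * x, I.mul_mem_left _ _ hx, of_mul_apply_add z x n,
      fun j hj => ?_⟩
    obtain ⟨j, rfl⟩ := Nat.exists_eq_add_of_le (show m ≤ j by omega)
    rw [of_mul_apply_add, hx' j (by omega), map_zero]
  mul_mem_right := by
    rintro m n _ ⟨x, hx, rfl, hx'⟩ z
    refine ⟨x * DirectSum.of A.deg n z, I.mul_mem_right _ _ hx, mul_of_apply_add z x m,
      fun j hj => ?_⟩
    obtain ⟨j, rfl⟩ := Nat.exists_eq_add_of_le' (show n ≤ j by omega)
    rw [mul_of_apply_add, hx' j (by omega), map_zero, LinearMap.zero_apply]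

theorem exists_leading {x : A.Total} (hx : x ≠ 0) :
    ∃ n, x n ≠ 0 ∧ ∀ j, n < j → x j = 0 := by
  classical
  have hne : (DFinsupp.support x).Nonempty :=
    Finset.nonempty_iff_ne_empty.2 fun h => hx (DFinsupp.support_eq_empty.1 h)
  refine ⟨(DFinsupp.support x).max' hne,
    DFinsupp.mem_support_iff.1 (Finset.max'_mem _ hne), fun j hj => ?_⟩
  by_contra h
  exact absurd (Finset.le_max' _ j (DFinsupp.mem_support_iff.2 h)) (not_le.2 hj)

theorem leadingIdeal_ne_bot {I : _root_.TwoSidedIdeal A.Total} (h : I ≠ ⊥) :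
    ∃ n, (leadingIdeal I).carrier n ≠ ⊥ := by
  obtain ⟨x, hx, hx₀⟩ : ∃ x ∈ I, x ≠ 0 := by
    by_contra! h'
    exact h (le_antisymm (fun x hx => (TwoSidedIdeal.mem_bot _).2 (h' x hx)) bot_le)
  obtain ⟨n, hn, hn'⟩ := exists_leading hx₀
  exact ⟨n, Submodule.ne_bot_iff _ |>.2 ⟨x n, ⟨x, hx, rfl, hn'⟩, hn⟩⟩

/-- The component of `x y` in the sum of the degrees of `x` and `y`. -/
theorem mul_apply_add {x y : A.Total} {m n : ℕ} (hx : ∀ j, m < j → x j = 0)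
    (hy : ∀ j, n < j → y j = 0) : (x * y) (m + n) = A.mul (x m) (y n) := by
  classical
  conv_lhs => rw [← DirectSum.sum_support_of y, Finset.mul_sum]
  rw [DFinsupp.finsetSum_apply]
  have key : ∀ j ∈ DFinsupp.support y, j ≠ n →
      (x * DirectSum.of A.deg j (y j)) (m + n) = 0 := by
    intro j _ hj
    rcases lt_or_gt_of_ne hj with h | h
    · obtain ⟨l, hl⟩ := Nat.exists_eq_add_of_le' (show j ≤ m + n by omega)
      rw [hl, mul_of_apply_add, hx l (by omega), map_zero, LinearMap.zero_apply]
    · rw [hy j h, map_zero, mul_zero, DirectSum.zero_apply]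
  rw [Finset.sum_eq_single n key, mul_of_apply_add]
  intro h
  rw [DFinsupp.notMem_support_iff.1 h, map_zero, mul_zero, DirectSum.zero_apply]

/-- Graded ideals give ordinary ideals by summing. Conversely an ordinary ideal is replaced by its
leading components: if the product of two leading components is nonzero, it is a component of the
product of the elements, which is then nonzero. -/
theorem isPrime_iff : A.IsPrime ↔ ∀ I J : GradedIdeal A, (∃ n, I.carrier n ≠ ⊥) →
    (∃ n, J.carrier n ≠ ⊥) →
    ∃ m n, ∃ x ∈ I.carrier m, ∃ y ∈ J.carrier n, A.mul x y ≠ 0 := by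
  classical
  constructor
  · intro h I J hI hJ
    obtain ⟨x, hx, y, hy, hxy⟩ := h I.total J.total (GradedIdeal.total_ne_bot hI)
      (GradedIdeal.total_ne_bot hJ)
    by_contra! h'
    refine hxy ?_
    rw [← DirectSum.sum_support_of x, ← DirectSum.sum_support_of y, Finset.sum_mul_sum]
    refine Finset.sum_eq_zero fun m _ => Finset.sum_eq_zero fun n _ => ?_
    rw [← of_mul, h' m n _ (GradedIdeal.mem_total.1 hx m) _ (GradedIdeal.mem_total.1 hy n),
      map_zero]
  · intro h I J hI hJ
    obtain ⟨m, n, _, ⟨x, hx, rfl, hx'⟩, _, ⟨y, hy, rfl, hy'⟩, hxy⟩ :=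
      h (leadingIdeal I) (leadingIdeal J) (leadingIdeal_ne_bot hI) (leadingIdeal_ne_bot hJ)
    refine ⟨x, hx, y, hy, fun h₀ => hxy ?_⟩
    rw [← mul_apply_add hx' hy', h₀, DirectSum.zero_apply]

/-! ### Commutativity in high degrees -/

/-- The commutator of `X` and `Y` is cancelled against two elements `Z`, `W` of high degree. Every
factor exchanged in the process absorbs `Z` or `W`, hence lies in the range where elements commute.
-/
theorem isComm_of_forall_ge (hA : A.LeftTorsionfree) {w : ℕ}
    (h : ∀ m n, w ≤ m → w ≤ n → ∀ (x : A.deg m) (y : A.deg n),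
      DirectSum.of A.deg m x * DirectSum.of A.deg n y =
        DirectSum.of A.deg n y * DirectSum.of A.deg m x) : isComm k A := by
  refine A.isComm_of_homogeneous fun {m n} x y => sigma_ext_of (add_comm _ _) ?_
  rw [of_mul, of_mul, ← sub_eq_zero]
  refine hA _ ⟨w, fun a ha z' => hA _ ⟨w, fun b hb z => ?_⟩⟩
  set X := DirectSum.of A.deg m x
  set Y := DirectSum.of A.deg n y
  set Z := DirectSum.of A.deg b z
  set W := DirectSum.of A.deg a z'
  have hWX : W * X = DirectSum.of A.deg (a + m) (A.mul z' x) := (of_mul _ _ _).symm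
  have hWY : W * Y = DirectSum.of A.deg (a + n) (A.mul z' y) := (of_mul _ _ _).symm
  have hYZ' : Y * Z = DirectSum.of A.deg (n + b) (A.mul y z) := (of_mul _ _ _).symm
  have hWXY : W * X * Y = DirectSum.of A.deg (a + m + n) (A.mul (A.mul z' x) y) := by
    rw [of_mul, of_mul]
  have e : Z * (W * (X * Y)) = Z * (W * (Y * X)) := by
    calc Z * (W * (X * Y)) = Z * (W * X * Y) := by rw [_root_.mul_assoc W]
      _ = W * X * Y * Z := by rw [hWXY]; exact h _ _ hb (by omega) _ _
      _ = W * X * (Y * Z) := _root_.mul_assoc _ _ _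
      _ = Y * Z * (W * X) := by rw [hWX, hYZ']; exact h _ _ (by omega) (by omega) _ _
      _ = Y * Z * W * X := (_root_.mul_assoc _ _ _).symm
      _ = W * (Y * Z) * X := by rw [hYZ']; rw [h _ _ (by omega) ha _ z']
      _ = W * Y * Z * X := by rw [_root_.mul_assoc W Y]
      _ = Z * (W * Y) * X := by rw [hWY, h _ _ (by omega) hb _ z]
      _ = Z * (W * (Y * X)) := by rw [_root_.mul_assoc, _root_.mul_assoc]
  rw [mul_sub, mul_sub, e, sub_self]

theorem trunc_iso_injective {B : GrAlg k} {w : ℕ} (φ : B.trunc w ≅ A.trunc w) (n : ℕ) :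
    Function.Injective (φ.hom.app n) := fun a b hab => by
  have e : ∀ a, φ.inv.app n (φ.hom.app n a) = a := fun a =>
    congrArg (fun f : B.trunc w ⟶ B.trunc w => f.app n a) φ.hom_inv_id
  rw [← e a, ← e b, hab]

theorem isComm_of_trunc_iso (hA : isComm k A) {B : GrAlg k} (hB : B.LeftTorsionfree) {w : ℕ}
    (φ : B.trunc w ≅ A.trunc w) : isComm k B := by
  refine isComm_of_forall_ge hB (w := w + 1) fun m n hm hn x y => ?_
  have hx : x ∈ B.truncDeg w m := by rw [truncDeg_of_le B (by omega) (by omega)]; trivial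
  have hy : y ∈ B.truncDeg w n := by rw [truncDeg_of_le B (by omega) (by omega)]; trivial
  have hxy : (⟨m + n, (B.trunc w).mul ⟨x, hx⟩ ⟨y, hy⟩⟩ : Σ n, B.truncDeg w n) =
      ⟨n + m, (B.trunc w).mul ⟨y, hy⟩ ⟨x, hx⟩⟩ := by
    have h₁ := φ.hom.map_mul ⟨x, hx⟩ ⟨y, hy⟩
    have h₂ := φ.hom.map_mul ⟨y, hy⟩ ⟨x, hx⟩
    have h₃ : (⟨m + n, A.mul (φ.hom.app m ⟨x, hx⟩).1 (φ.hom.app n ⟨y, hy⟩).1⟩ : Σ n, A.deg n) =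
        ⟨n + m, A.mul (φ.hom.app n ⟨y, hy⟩).1 (φ.hom.app m ⟨x, hx⟩).1⟩ :=
      sigma_ext_of (add_comm _ _) (by rw [of_mul, of_mul]; exact hA _ _)
    have h₄ : (⟨m + n, φ.hom.app (m + n) ((B.trunc w).mul ⟨x, hx⟩ ⟨y, hy⟩)⟩ :
        Σ n, A.truncDeg w n) = ⟨n + m, φ.hom.app (n + m) ((B.trunc w).mul ⟨y, hy⟩ ⟨x, hx⟩)⟩ := by
      rw [h₁, h₂]
      exact Operad.sigma_subtype_ext h₃
    have inj : ∀ {a b : ℕ} (p : B.truncDeg w a) (q : B.truncDeg w b),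
        (⟨a, φ.hom.app a p⟩ : Σ n, A.truncDeg w n) = ⟨b, φ.hom.app b q⟩ →
        (⟨a, p⟩ : Σ n, B.truncDeg w n) = ⟨b, q⟩ := by
      intro a b p q h
      obtain rfl : a = b := congrArg Sigma.fst h
      rw [trunc_iso_injective φ a (eq_of_heq (Sigma.mk.inj h).2)]
    exact inj _ _ h₄
  rw [← of_mul, ← of_mul]
  refine of_eq_of_sigma_eq ?_
  exact congrArg (fun s : Σ n, B.truncDeg w n => (⟨s.1, s.2.1⟩ : Σ n, B.deg n)) hxy

end GrAlg

/-! ### The dictionary between operads and graded algebras -/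

/-- An identification of the components of an operad `P` with those of a graded algebra `A` under
which permutations act through their signs by operators `t`, and `x ∘ᵢ y` corresponds to the
product of `t ((-1) ^ (i deg y)) x` and `y`. -/
structure Comparison (P : Operad k) (A : GrAlg k) (t : ∀ n, ℤˣ → A.deg n →ₗ[k] A.deg n) where
  equiv : ∀ n, P.ops n ≃ₗ[k] A.deg n
  twist_zero : ∀ (u : ℤˣ) (x : A.deg 0), t 0 u x = x
  map_one : equiv 0 P.one = A.one
  map_act : ∀ {n : ℕ} (σ : Equiv.Perm (Fin (n + 1))) (x : P.ops n),
    equiv n (P.act σ x) = t n (Equiv.Perm.sign σ) (equiv n x)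
  map_comp : ∀ {m n : ℕ} (i : Fin (m + 1)) (x : P.ops m) (y : P.ops n),
    equiv (m + n) (P.comp i x y) = A.mul (t m ((-1) ^ (i.1 * n)) (equiv m x)) (equiv n y)

namespace Comparison

variable {P Q : Operad k} {A B : GrAlg k} {t : ∀ n, ℤˣ → A.deg n →ₗ[k] A.deg n}
  {s : ∀ n, ℤˣ → B.deg n →ₗ[k] B.deg n} (C : Comparison P A t) (D : Comparison Q B s)

theorem twist_one (C : Comparison P A t) {n : ℕ} (x : A.deg n) : t n 1 x = x := by
  obtain ⟨x, rfl⟩ := (C.equiv n).surjective x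
  rw [← Equiv.Perm.sign_one (α := Fin (n + 1)), ← C.map_act, P.act_one]

/-- In degree `0` the only permutation is even, so `map_act` leaves `t 0 (-1)` undetermined; the
field `twist_zero` fixes it. -/
theorem map_signAct {n : ℕ} (u : ℤˣ) (x : P.ops n) :
    C.equiv n (P.signAct u x) = t n u (C.equiv n x) := by
  by_cases hn : n = 0
  · subst hn
    rw [Operad.signAct_degree_zero, C.twist_zero]
  rcases Int.units_eq_one_or u with rfl | rfl
  · rw [Operad.signAct_one, C.twist_one]
  · rw [Operad.signAct_neg_one, C.map_act, sign_swap_zero_last hn]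

theorem map_comp_zero {m n : ℕ} (x : P.ops m) (y : P.ops n) :
    C.equiv (m + n) (P.comp 0 x y) = A.mul (C.equiv m x) (C.equiv n y) := by
  rw [C.map_comp, Fin.val_zero, zero_mul, pow_zero, C.twist_one]

/-! ### Homomorphisms -/

/-- The homomorphism of graded algebras that corresponds to a morphism of operads. -/
def algHom (f : P ⟶ Q) : A ⟶ B where
  app n := (D.equiv n).toLinearMap ∘ₗ f.app n ∘ₗ (C.equiv n).symm.toLinearMap
  map_one := by
    simp only [LinearMap.comp_apply, LinearEquiv.coe_coe]
    rw [← C.map_one, LinearEquiv.symm_apply_apply, f.map_one, D.map_one]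
  map_mul {m n} x y := by
    obtain ⟨x, rfl⟩ := (C.equiv m).surjective x
    obtain ⟨y, rfl⟩ := (C.equiv n).surjective y
    simp only [LinearMap.comp_apply, LinearEquiv.coe_coe]
    rw [← C.map_comp_zero, LinearEquiv.symm_apply_apply, LinearEquiv.symm_apply_apply,
      LinearEquiv.symm_apply_apply, f.map_comp, D.map_comp_zero]

theorem algHom_app (f : P ⟶ Q) {n : ℕ} (x : P.ops n) :
    (C.algHom D f).app n (C.equiv n x) = D.equiv n (f.app n x) := by
  simp [algHom]

/-- Equivariance under one transposition already encodes the twist. This is the condition that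
`opHom` demands in the opposite direction. -/
theorem algHom_twist (f : P ⟶ Q) {n : ℕ} (u : ℤˣ) (x : A.deg n) :
    (C.algHom D f).app n (t n u x) = s n u ((C.algHom D f).app n x) := by
  obtain ⟨x, rfl⟩ := (C.equiv n).surjective x
  rw [← C.map_signAct, algHom_app, algHom_app, ← D.map_signAct]
  congr 1
  rcases Int.units_eq_one_or u with rfl | rfl
  · rw [Operad.signAct_one, Operad.signAct_one]
  · rw [Operad.signAct_neg_one, Operad.signAct_neg_one, f.map_act]

/-- The morphism of operads that corresponds to a homomorphism of graded algebras that commutes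
with the operators `t`. -/
def opHom (g : A ⟶ B)
    (hg : ∀ (n : ℕ) (u : ℤˣ) (x : A.deg n), g.app n (t n u x) = s n u (g.app n x)) : P ⟶ Q where
  app n := (D.equiv n).symm.toLinearMap ∘ₗ g.app n ∘ₗ (C.equiv n).toLinearMap
  map_one := by
    simp only [LinearMap.comp_apply, LinearEquiv.coe_coe]
    rw [C.map_one, g.map_one, ← D.map_one, LinearEquiv.symm_apply_apply]
  map_act σ x := (D.equiv _).injective (by
    simp only [LinearMap.comp_apply, LinearEquiv.coe_coe]
    rw [D.map_act, LinearEquiv.apply_symm_apply, LinearEquiv.apply_symm_apply, C.map_act, hg])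
  map_comp i x y := (D.equiv _).injective (by
    simp only [LinearMap.comp_apply, LinearEquiv.coe_coe]
    rw [D.map_comp, LinearEquiv.apply_symm_apply, LinearEquiv.apply_symm_apply,
      LinearEquiv.apply_symm_apply, C.map_comp, g.map_mul, hg])

theorem equiv_opHom_app (g : A ⟶ B)
    (hg : ∀ (n : ℕ) (u : ℤˣ) (x : A.deg n), g.app n (t n u x) = s n u (g.app n x)) {n : ℕ}
    (x : P.ops n) : D.equiv n ((C.opHom D g hg).app n x) = g.app n (C.equiv n x) := by
  simp [opHom]

/-- The isomorphism of graded algebras that corresponds to an isomorphism of operads. -/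
def algIso (φ : P ≅ Q) : A ≅ B where
  hom := C.algHom D φ.hom
  inv := D.algHom C φ.inv
  hom_inv_id := GrAlg.Hom.ext (funext fun n => LinearMap.ext fun x => by
    obtain ⟨x, rfl⟩ := (C.equiv n).surjective x
    change (D.algHom C φ.inv).app n ((C.algHom D φ.hom).app n (C.equiv n x)) = C.equiv n x
    rw [algHom_app, algHom_app]
    exact congrArg (fun f : P ⟶ P => C.equiv n (f.app n x)) φ.hom_inv_id)
  inv_hom_id := GrAlg.Hom.ext (funext fun n => LinearMap.ext fun x => by
    obtain ⟨x, rfl⟩ := (D.equiv n).surjective x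
    change (C.algHom D φ.hom).app n ((D.algHom C φ.inv).app n (D.equiv n x)) = D.equiv n x
    rw [algHom_app, algHom_app]
    exact congrArg (fun f : Q ⟶ Q => D.equiv n (f.app n x)) φ.inv_hom_id)

/-- The isomorphism of operads that corresponds to an isomorphism of graded algebras that commutes
with the operators `t`. -/
def opIso (φ : A ≅ B)
    (h : ∀ (n : ℕ) (u : ℤˣ) (x : A.deg n), φ.hom.app n (t n u x) = s n u (φ.hom.app n x))
    (h' : ∀ (n : ℕ) (u : ℤˣ) (x : B.deg n), φ.inv.app n (s n u x) = t n u (φ.inv.app n x)) :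
    P ≅ Q where
  hom := C.opHom D φ.hom h
  inv := D.opHom C φ.inv h'
  hom_inv_id := Operad.Hom.ext (funext fun n => LinearMap.ext fun x => (C.equiv n).injective (by
    change C.equiv n ((D.opHom C φ.inv h').app n ((C.opHom D φ.hom h).app n x)) = C.equiv n x
    rw [equiv_opHom_app, equiv_opHom_app]
    exact congrArg (fun f : A ⟶ A => f.app n (C.equiv n x)) φ.hom_inv_id))
  inv_hom_id := Operad.Hom.ext (funext fun n => LinearMap.ext fun x => (D.equiv n).injective (by
    change D.equiv n ((C.opHom D φ.hom h).app n ((D.opHom C φ.inv h').app n x)) = D.equiv n x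
    rw [equiv_opHom_app, equiv_opHom_app]
    exact congrArg (fun f : B ⟶ B => f.app n (D.equiv n x)) φ.inv_hom_id))

/-! ### Truncations -/

section Trunc

variable {w v : ℕ} (hwv : ∀ n, n ≠ 0 → (w ≤ n + 1 ↔ v ≤ n))

include hwv in
-- The level `w` bounds the arity `n + 1` and `v` the degree `n`. Only `n ≠ 0` matters, since in
-- degree `0` both truncations are the line of the identity.
theorem map_truncOps (n : ℕ) :
    (P.truncOps w n).map (C.equiv n).toLinearMap = A.truncDeg v n := by
  by_cases hn : n = 0
  · subst hn
    refine (Submodule.map_span _ _).trans ?_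
    rw [Set.image_singleton]
    exact congrArg (fun x => k ∙ x) C.map_one
  by_cases h : v ≤ n
  · rw [P.truncOps_of_le ((hwv n hn).2 h) hn, A.truncDeg_of_le h hn, Submodule.map_top,
      LinearEquiv.range]
  · rw [P.truncOps_of_lt (not_le.1 fun h' => h ((hwv n hn).1 h')) hn,
      A.truncDeg_of_lt (not_le.1 h) hn, Submodule.map_bot]

theorem twist_mem_truncDeg (C : Comparison P A t) (v : ℕ) {n : ℕ} (u : ℤˣ) (x : A.deg n)
    (hx : x ∈ A.truncDeg v n) : t n u x ∈ A.truncDeg v n := by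
  by_cases hn : n = 0
  · subst hn; rwa [C.twist_zero]
  by_cases h : v ≤ n
  · rw [A.truncDeg_of_le h hn]; trivial
  · rw [A.truncDeg_of_lt (not_le.1 h) hn, Submodule.mem_bot] at hx
    rw [hx, map_zero]; exact zero_mem _

/-- The operators on the truncated algebra. -/
def truncTwist (C : Comparison P A t) (v n : ℕ) (u : ℤˣ) :
    (A.trunc v).deg n →ₗ[k] (A.trunc v).deg n :=
  (t n u).restrict (p := A.truncDeg v n) (q := A.truncDeg v n)
    fun x hx => C.twist_mem_truncDeg v u x hx

/-- The comparison of the truncations. -/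
def trunc : Comparison (P.trunc w) (A.trunc v) (C.truncTwist v) where
  equiv n := (C.equiv n).ofSubmodules _ _ (C.map_truncOps hwv n)
  twist_zero u _ := Subtype.ext (C.twist_zero u _)
  map_one := Subtype.ext C.map_one
  map_act σ _ := Subtype.ext (C.map_act σ _)
  map_comp i _ _ := Subtype.ext (C.map_comp i _ _)

theorem coe_trunc_equiv {n : ℕ} (x : P.truncOps w n) :
    ((C.trunc hwv).equiv n x : A.truncDeg v n).1 = C.equiv n x.1 := rfl

end Trunc

/-! ### Torsionfreeness, dimension, primeness -/

include C in
theorem leftTorsionfree_iff : P.LeftTorsionfree ↔ A.LeftTorsionfree := by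
  rw [GrAlg.leftTorsionfree_iff]
  constructor
  · rintro h m x ⟨N, hN⟩
    obtain ⟨x, rfl⟩ := (C.equiv m).surjective x
    rw [h m x ⟨N, fun n hn i z => (C.equiv _).injective ?_⟩, map_zero]
    rw [C.map_comp, hN n hn, map_zero]
  · rintro h m x ⟨N, hN⟩
    refine (C.equiv m).injective ?_
    rw [map_zero]
    refine h m _ ⟨N, fun n hn z => ?_⟩
    obtain ⟨z, rfl⟩ := (C.equiv n).surjective z
    rw [← C.map_comp_zero, hN n hn, map_zero]

include C in
theorem infiniteDimensional_iff : P.InfiniteDimensional ↔ A.InfiniteDimensional := by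
  let e : (⨁ n, P.ops n) ≃ₗ[k] ⨁ n, A.deg n := DFinsupp.mapRange.linearEquiv C.equiv
  exact not_congr ⟨fun _ => Module.Finite.equiv e, fun _ => Module.Finite.equiv e.symm⟩

include C in
theorem isPrime_operad (h : A.IsPrime) : P.IsPrime := by
  rw [GrAlg.isPrime_iff] at h
  intro I J hI hJ
  have key : ∀ I : P.TwoSidedIdeal, ∃ I' : GrAlg.GradedIdeal A,
      ∀ n, I'.carrier n = (I.carrier n).map (C.equiv n).toLinearMap := fun I =>
    ⟨{ carrier := fun n => (I.carrier n).map (C.equiv n).toLinearMap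
       mul_mem_left := by
        rintro m n z _ ⟨x, hx, rfl⟩
        obtain ⟨z, rfl⟩ := (C.equiv m).surjective z
        exact ⟨_, I.comp_mem_left 0 z x hx, C.map_comp_zero z x⟩
       mul_mem_right := by
        rintro m n _ ⟨x, hx, rfl⟩ z
        obtain ⟨z, rfl⟩ := (C.equiv n).surjective z
        exact ⟨_, I.comp_mem_right 0 x hx z, C.map_comp_zero x z⟩ }, fun _ => rfl⟩
  have ne : ∀ n (S : Submodule k (P.ops n)), S ≠ ⊥ → S.map (C.equiv n).toLinearMap ≠ ⊥ :=
    fun n S hS h => hS ((Submodule.map_eq_bot_iff (e := C.equiv n)).1 h)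
  obtain ⟨I', hI'⟩ := key I
  obtain ⟨J', hJ'⟩ := key J
  obtain ⟨m, n, x, hx, y, hy, hxy⟩ := h I' J' (hI.imp fun n h => by rw [hI']; exact ne n _ h)
    (hJ.imp fun n h => by rw [hJ']; exact ne n _ h)
  rw [hI'] at hx
  rw [hJ'] at hy
  obtain ⟨x, hx, rfl⟩ := hx
  obtain ⟨y, hy, rfl⟩ := hy
  refine ⟨m, n, 0, x, hx, y, hy, fun h₀ => hxy ?_⟩
  exact (C.map_comp_zero x y).symm.trans (by rw [h₀, map_zero])

theorem comap_ne_bot {n : ℕ} {S : Submodule k (A.deg n)} (hS : S ≠ ⊥) :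
    S.comap (C.equiv n).toLinearMap ≠ ⊥ := by
  intro h
  obtain ⟨x, hx, hx₀⟩ := Submodule.exists_mem_ne_zero_of_ne_bot hS
  obtain ⟨x, rfl⟩ := (C.equiv n).surjective x
  have : x ∈ S.comap (C.equiv n).toLinearMap := hx
  rw [h, Submodule.mem_bot] at this
  exact hx₀ (by rw [this, map_zero])

include C in
-- A graded ideal of the algebra comes from an operadic ideal only if it is stable under the action,
-- that is, under the twists; `ht` provides this.
theorem isPrime_algebra (ht : ∀ n u (S : Submodule k (A.deg n)), ∀ x ∈ S, t n u x ∈ S)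
    (h : P.IsPrime) : A.IsPrime := by
  rw [GrAlg.isPrime_iff]
  intro I J hI hJ
  have key : ∀ I : GrAlg.GradedIdeal A, ∃ I' : P.TwoSidedIdeal,
      ∀ n, I'.carrier n = (I.carrier n).comap (C.equiv n).toLinearMap := fun I =>
    ⟨{ carrier := fun n => (I.carrier n).comap (C.equiv n).toLinearMap
       act_mem := fun σ x hx => by
        rw [Submodule.mem_comap, LinearEquiv.coe_coe] at hx ⊢
        rw [C.map_act]
        exact ht _ _ _ _ hx
       comp_mem_left := fun i z x hx => by
        rw [Submodule.mem_comap, LinearEquiv.coe_coe] at hx ⊢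
        rw [C.map_comp]
        exact I.mul_mem_left _ _ hx
       comp_mem_right := fun i x hx z => by
        rw [Submodule.mem_comap, LinearEquiv.coe_coe] at hx ⊢
        rw [C.map_comp]
        exact I.mul_mem_right _ (ht _ _ _ _ hx) _ }, fun _ => rfl⟩
  obtain ⟨I', hI'⟩ := key I
  obtain ⟨J', hJ'⟩ := key J
  obtain ⟨m, n, i, x, hx, y, hy, hxy⟩ := h I' J' (hI.imp fun n h => by rw [hI']; exact C.comap_ne_bot h)
    (hJ.imp fun n h => by rw [hJ']; exact C.comap_ne_bot h)
  rw [hI'] at hx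
  rw [hJ'] at hy
  -- The nonzero composite may use any input `i`, so the witness in the first ideal is the twisted
  -- element.
  exact ⟨m, n, _, ht _ ((-1) ^ (i.1 * n)) _ _ hx, _, hy, fun h₀ => hxy ((C.equiv _).injective
    ((C.map_comp i x y).trans (h₀.trans (map_zero _).symm)))⟩

end Comparison

/-! ### Extension of homomorphisms -/

namespace Comparison

variable {P Q : Operad k} {A B : GrAlg k} {t : ∀ n, ℤˣ → A.deg n →ₗ[k] A.deg n}
  {s : ∀ n, ℤˣ → B.deg n →ₗ[k] B.deg n} (C : Comparison P A t) (D : Comparison Q B s)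
  {w v : ℕ} (hwv : ∀ n, n ≠ 0 → (w ≤ n + 1 ↔ v ≤ n))

theorem exists_extension_operad (φ : Q.trunc w ≅ P.trunc w) (g : B ⟶ A)
    (hg : ∀ (n : ℕ) (u : ℤˣ) (x : B.deg n), g.app n (s n u x) = t n u (g.app n x))
    (hinj : ∀ n, Function.Injective (g.app n))
    (hext : ∀ (n : ℕ) (x : B.truncDeg v n),
      g.app n x.1 = (((D.trunc hwv).algHom (C.trunc hwv) φ.hom).app n x : A.truncDeg v n).1) :
    ∃ ψ : Q ⟶ P, (∀ n, Function.Injective (ψ.app n)) ∧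
      ∀ (n : ℕ) (x : Q.truncOps w n), ψ.app n x.1 = (φ.hom.app n x).1 := by
  refine ⟨D.opHom C g hg, fun n x y h => ?_, fun n x => (C.equiv n).injective ?_⟩
  · have := congrArg (C.equiv n) h
    rw [equiv_opHom_app, equiv_opHom_app] at this
    exact (D.equiv n).injective (hinj n this)
  · rw [equiv_opHom_app, ← coe_trunc_equiv D hwv, hext, algHom_app]
    exact coe_trunc_equiv C hwv _

theorem exists_extension_algebra (φ : B.trunc v ≅ A.trunc v)
    (h : ∀ (n : ℕ) (u : ℤˣ) (x : (B.trunc v).deg n),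
      φ.hom.app n (D.truncTwist v n u x) = C.truncTwist v n u (φ.hom.app n x))
    (f : Q ⟶ P) (hinj : ∀ n, Function.Injective (f.app n))
    (hext : ∀ (n : ℕ) (x : Q.truncOps w n),
      f.app n x.1 = (((D.trunc hwv).opHom (C.trunc hwv) φ.hom h).app n x : P.truncOps w n).1) :
    (∀ n, Function.Injective ((D.algHom C f).app n)) ∧
      ∀ (n : ℕ) (x : B.truncDeg v n), (D.algHom C f).app n x.1 = (φ.hom.app n x).1 := by
  refine ⟨fun n x y h => ?_, fun n x => ?_⟩
  · obtain ⟨x, rfl⟩ := (D.equiv n).surjective x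
    obtain ⟨y, rfl⟩ := (D.equiv n).surjective y
    rw [algHom_app, algHom_app] at h
    rw [hinj n ((C.equiv n).injective h)]
  · obtain ⟨x, rfl⟩ := ((D.trunc hwv).equiv n).surjective x
    rw [coe_trunc_equiv D hwv, algHom_app, hext, ← coe_trunc_equiv C hwv, equiv_opHom_app]

end Comparison

theorem exists_algebra_trunc_index {w : ℕ} (hw : 0 < w) :
    ∃ v, 0 < v ∧ ∀ n, n ≠ 0 → (w ≤ n + 1 ↔ v ≤ n) :=
  -- Arity `w` is degree `w - 1`; the maximum with `1` keeps the level positive and changes nothing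
  -- in degrees `n ≠ 0`.
  ⟨max 1 (w - 1), by omega, fun n hn => by omega⟩

/-! ### Commutative graded algebras and `S`-trivial operads -/

section STrivial

/-- The comparison of a commutative graded algebra and its operad. -/
def comparisonToOperad (A : GrAlg k) (hA : GrAlg.isComm k A) :
    Comparison (A.toOperad hA) A (fun _ _ => LinearMap.id) where
  equiv _ := LinearEquiv.refl k _
  twist_zero _ _ := rfl
  map_one := rfl
  map_act _ _ := rfl
  map_comp _ _ _ := rfl

/-- The comparison of an `S`-trivial operad and its graded algebra. -/
def comparisonToGrAlg (P : Operad k) (hP : Operad.isSTrivial k P) :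
    Comparison P P.toGrAlg (fun _ _ => LinearMap.id) where
  equiv _ := LinearEquiv.refl k _
  twist_zero _ _ := rfl
  map_one := rfl
  map_act σ x := hP _ σ x
  map_comp i x y := Operad.comp_eq_comp_zero hP i x y

variable {P : Operad k} {A : GrAlg k}

/-- The competitor `Q` is shown to be `S`-trivial, the extension problem is solved for its algebra,
and the solution is carried back. -/
theorem Comparison.isSaturated_operad (C : Comparison P A (fun _ _ => LinearMap.id))
    (hP : Operad.isSTrivial k P) (hA : A.IsSaturated) : P.IsSaturated := by
  refine ⟨C.leftTorsionfree_iff.2 hA.1, fun Q hQ w hw φ => ?_⟩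
  have hQS := Operad.isSTrivial_of_trunc_iso hP hQ φ
  let D := comparisonToGrAlg Q hQS
  obtain ⟨v, hv, hwv⟩ := exists_algebra_trunc_index hw
  obtain ⟨g, hg, hext⟩ := hA.2 _ (D.leftTorsionfree_iff.1 hQ) v hv
    ((D.trunc hwv).algIso (C.trunc hwv) φ)
  exact C.exists_extension_operad D hwv φ g (fun _ _ _ => rfl) hg hext

theorem Comparison.isSaturated_algebra (C : Comparison P A (fun _ _ => LinearMap.id))
    (hA : GrAlg.isComm k A) (hP : P.IsSaturated) : A.IsSaturated := by
  refine ⟨C.leftTorsionfree_iff.1 hP.1, fun B hB v hv φ => ?_⟩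
  have hBc := GrAlg.isComm_of_trunc_iso hA hB φ
  let D := comparisonToOperad B hBc
  have hwv : ∀ n, n ≠ 0 → (v + 1 ≤ n + 1 ↔ v ≤ n) := fun n _ => by omega
  obtain ⟨f, hf, hext⟩ := hP.2 _ (D.leftTorsionfree_iff.2 hB) (v + 1) (Nat.succ_pos _)
    ((D.trunc hwv).opIso (C.trunc hwv) φ (fun _ _ _ => rfl) (fun _ _ _ => rfl))
  exact ⟨D.algHom C f, C.exists_extension_algebra D hwv φ (fun _ _ _ => rfl) f hf hext⟩

end STrivial

/-! ### PGC algebras and `A`-trivial operads -/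

namespace TypedGrAlg

variable {A B : TypedGrAlg k}

/-- An odd component would have to equal its negative. Through this and its odd analogue, commuting
with `twist` amounts to respecting types. -/
theorem mem_even_of_twist (h2 : (2 : k) ≠ 0) (hA : A.IsPGC) {n : ℕ} (hn : n ≠ 0) {x : A.deg n}
    (hx : twist hA (-1) x = x) : x ∈ A.even n := by
  obtain ⟨e, he, o, ho, rfl⟩ := exists_even_add_odd hA hn x
  rw [map_add, twist_even hA _ he, twist_odd hA _ ho, add_right_inj] at hx
  have : (2 : k) • o = 0 := by
    rw [two_smul]
    nth_rewrite 1 [← hx]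
    simp
  rw [(smul_eq_zero.1 this).resolve_left h2, add_zero]
  exact he

theorem mem_odd_of_twist (h2 : (2 : k) ≠ 0) (hA : A.IsPGC) {n : ℕ} (hn : n ≠ 0) {x : A.deg n}
    (hx : twist hA (-1) x = -x) : x ∈ A.odd n := by
  obtain ⟨e, he, o, ho, rfl⟩ := exists_even_add_odd hA hn x
  rw [map_add, twist_even hA _ he, twist_odd hA _ ho, neg_add] at hx
  have hx' : e = -e := by simpa using hx
  have : (2 : k) • e = 0 := by
    rw [two_smul]
    nth_rewrite 1 [hx']
    simp
  rw [(smul_eq_zero.1 this).resolve_left h2, zero_add]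
  exact ho

theorem twist_neg_one_odd (hA : A.IsPGC) {n : ℕ} {x : A.deg n} (hx : x ∈ A.odd n) :
    twist hA (-1) x = -x := by
  rw [twist_odd hA _ hx]; simp

/-- Elements corresponding to even elements under a map that commutes with `twist` are even. -/
theorem mem_even_of_mem_even (h2 : (2 : k) ≠ 0) (hA : A.IsPGC) (hB : B.IsPGC) {n : ℕ}
    {x : A.deg n} {y : B.deg n} (h₀ : x = 0 → y = 0)
    (h : twist hA (-1) x = x → twist hB (-1) y = y) (hx : x ∈ A.even n) : y ∈ B.even n := by
  by_cases hn : n = 0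
  · subst hn
    rw [A.even_zero, Submodule.mem_bot] at hx
    rw [h₀ hx]; exact zero_mem _
  · exact mem_even_of_twist h2 hB hn (h (twist_even hA _ hx))

/-- Elements corresponding to odd elements under a map that commutes with `twist` are odd. -/
theorem mem_odd_of_mem_odd (h2 : (2 : k) ≠ 0) (hA : A.IsPGC) (hB : B.IsPGC) {n : ℕ}
    {x : A.deg n} {y : B.deg n} (h₀ : x = 0 → y = 0)
    (h : twist hA (-1) x = -x → twist hB (-1) y = -y) (hx : x ∈ A.odd n) : y ∈ B.odd n := by
  by_cases hn : n = 0
  · subst hn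
    rw [A.odd_zero, Submodule.mem_bot] at hx
    rw [h₀ hx]; exact zero_mem _
  · exact mem_odd_of_twist h2 hB hn (h (twist_neg_one_odd hA hx))

/-- In positive degree a truncation is everything or zero, so even and odd parts of an element stay
inside it. Naming `y` separately avoids a twist on the truncated algebra, for which no PGC structure
is assumed. -/
theorem twist_trunc_hom (hA : A.IsPGC) (hB : B.IsPGC) {v : ℕ} (g : A.trunc v ⟶ B.trunc v) {n : ℕ}
    (u : ℤˣ) (x y : A.truncDeg v n) (h : y.1 = twist hA u x.1) :
    (g.app n y).1 = twist hB u (g.app n x).1 := by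
  by_cases hn : n = 0
  · rw [twist_zero hB hn]
    rw [twist_zero hA hn] at h
    rw [Subtype.ext h]
  by_cases hv : v ≤ n
  · have ht : ∀ z : A.deg n, z ∈ A.truncDeg v n := fun z => by
      rw [A.truncDeg_of_le hv hn]; trivial
    obtain ⟨x, hx⟩ := x
    obtain ⟨e, he, o, ho, rfl⟩ := exists_even_add_odd hA hn x
    have hy : y = (⟨e, ht e⟩ : A.truncDeg v n) + ((u : ℤ) : k) • ⟨o, ht o⟩ := Subtype.ext (by
      rw [h, map_add, twist_even hA _ he, twist_odd hA _ ho]; rfl)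
    have hx' : (⟨e + o, hx⟩ : A.truncDeg v n) = ⟨e, ht e⟩ + ⟨o, ht o⟩ := rfl
    have he' : (g.app n ⟨e, ht e⟩).1 ∈ B.even n := g.map_even n ⟨e, ht e⟩ he
    have ho' : (g.app n ⟨o, ht o⟩).1 ∈ B.odd n := g.map_odd n ⟨o, ht o⟩ ho
    rw [hy, hx', map_add, map_add, map_smul, Submodule.coe_add, Submodule.coe_add,
      Submodule.coe_smul, map_add, twist_even hB _ he', twist_odd hB _ ho']
  · have h₀ : ∀ z : A.truncDeg v n, z = 0 := fun z => by
      exact Subtype.ext ((Submodule.mem_bot k).1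
        ((A.truncDeg_of_lt (not_le.1 hv) hn).le z.2))
    rw [h₀ y, h₀ x, map_zero, Submodule.coe_zero, map_zero]

theorem trunc_hom_even (h2 : (2 : k) ≠ 0) (hA : A.IsPGC) (hB : B.IsPGC) {v : ℕ}
    (g : A.toGrAlg.trunc v ⟶ B.toGrAlg.trunc v)
    (hg : ∀ n (x y : A.truncDeg v n), y.1 = twist hA (-1) x.1 →
      (g.app n y).1 = twist hB (-1) (g.app n x).1) (n : ℕ) (x : A.truncDeg v n)
    (hx : x ∈ (A.trunc v).even n) : g.app n x ∈ (B.trunc v).even n := by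
  have : (g.app n x).1 ∈ B.even n := by
    refine mem_even_of_mem_even h2 hA hB (x := x.1) (fun h => ?_) (fun h => ?_) hx
    · obtain rfl : x = 0 := Subtype.ext h
      exact congrArg Subtype.val (map_zero (g.app n))
    · exact (hg n x x h.symm).symm
  exact this

theorem trunc_hom_odd (h2 : (2 : k) ≠ 0) (hA : A.IsPGC) (hB : B.IsPGC) {v : ℕ}
    (g : A.toGrAlg.trunc v ⟶ B.toGrAlg.trunc v)
    (hg : ∀ n (x y : A.truncDeg v n), y.1 = twist hA (-1) x.1 →
      (g.app n y).1 = twist hB (-1) (g.app n x).1) (n : ℕ) (x : A.truncDeg v n)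
    (hx : x ∈ (A.trunc v).odd n) : g.app n x ∈ (B.trunc v).odd n := by
  have : (g.app n x).1 ∈ B.odd n := by
    refine mem_odd_of_mem_odd h2 hA hB (x := x.1) (fun h => ?_) (fun h => ?_) hx
    · obtain rfl : x = 0 := Subtype.ext h
      exact congrArg Subtype.val (map_zero (g.app n))
    · exact (hg n x (-x) h.symm).symm.trans (congrArg Subtype.val (map_neg (g.app n) x))
  exact this

/-- The underlying isomorphism of graded algebras. -/
def isoToGrAlg (φ : A ≅ B) : A.toGrAlg ≅ B.toGrAlg where
  hom := φ.hom.toHom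
  inv := φ.inv.toHom
  hom_inv_id := congrArg (fun f : A ⟶ A => (f.toHom : A.toGrAlg ⟶ A.toGrAlg)) φ.hom_inv_id
  inv_hom_id := congrArg (fun f : B ⟶ B => (f.toHom : B.toGrAlg ⟶ B.toGrAlg)) φ.inv_hom_id

/-- An isomorphism of graded algebras that preserves types in both directions. -/
def isoOfGrAlg (φ : A.toGrAlg ≅ B.toGrAlg)
    (he : ∀ n, ∀ x ∈ A.even n, φ.hom.app n x ∈ B.even n)
    (ho : ∀ n, ∀ x ∈ A.odd n, φ.hom.app n x ∈ B.odd n)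
    (he' : ∀ n, ∀ x ∈ B.even n, φ.inv.app n x ∈ A.even n)
    (ho' : ∀ n, ∀ x ∈ B.odd n, φ.inv.app n x ∈ A.odd n) : A ≅ B where
  hom := ⟨φ.hom, he, ho⟩
  inv := ⟨φ.inv, he', ho'⟩
  hom_inv_id := TypedGrAlg.Hom.ext
    (congrArg (fun f : A.toGrAlg ⟶ A.toGrAlg => f.app) φ.hom_inv_id)
  inv_hom_id := TypedGrAlg.Hom.ext
    (congrArg (fun f : B.toGrAlg ⟶ B.toGrAlg => f.app) φ.inv_hom_id)

end TypedGrAlg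

section ATrivial

open TypedGrAlg

/-- The comparison of a PGC algebra and its operad. -/
def comparisonOfPGC (A : TypedGrAlg k) (hA : A.IsPGC) :
    Comparison (A.toOperad hA) A.toGrAlg (fun _ u => twist hA u) where
  equiv _ := LinearEquiv.refl k _
  twist_zero u x := TypedGrAlg.twist_zero hA rfl u x
  map_one := rfl
  map_act _ _ := rfl
  map_comp _ _ _ := rfl

/-- The comparison of a left torsionfree `A`-trivial operad and its PGC algebra. -/
def comparisonToTypedGrAlg (P : Operad k) (hP : Operad.isATrivial k P) (ht : P.LeftTorsionfree)
    (hA : P.toTypedGrAlg.IsPGC) :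
    Comparison P P.toGrAlg (fun _ u => twist hA u) where
  equiv _ := LinearEquiv.refl k _
  twist_zero u x := TypedGrAlg.twist_zero hA rfl u x
  map_one := rfl
  map_act σ x := (Operad.act_eq_signAct hP σ x).trans
    (Operad.twist_toTypedGrAlg hP hA _ x).symm
  map_comp {m n} i x y := by
    change P.comp i x y = P.comp 0 (twist hA ((-1) ^ (i.1 * n)) x) y
    rw [Operad.twist_toTypedGrAlg hP hA]
    by_cases hm : m = 0
    · subst hm
      obtain rfl : i = 0 := Fin.ext (by omega)
      rw [Operad.signAct_degree_zero]
    · rw [Operad.signAct_comp_zero hP ht hm, Operad.comp_eq_signAct hP ht hm i 0, Fin.val_zero,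
        add_zero]

variable {P : Operad k} {A : TypedGrAlg k}

/-- Beyond the `S`-trivial argument, the isomorphism of truncated algebras must respect types. It
commutes with the twists because it comes from operads, and `2 ≠ 0` turns this into preservation of
even and odd elements. -/
theorem Comparison.isSaturated_of_isSaturatedPGC (h2 : (2 : k) ≠ 0) (hA : A.IsSaturatedPGC)
    (C : Comparison P A.toGrAlg (fun _ u => twist hA.1 u)) (hP : Operad.isATrivial k P) :
    P.IsSaturated := by
  refine ⟨C.leftTorsionfree_iff.2 hA.2.1, fun Q hQ w hw φ => ?_⟩
  have hQA := Operad.isATrivial_of_trunc_iso hP hQ φ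
  have hB := Operad.isPGC_toTypedGrAlg h2 hQA hQ
  let D := comparisonToTypedGrAlg Q hQA hQ hB
  obtain ⟨v, hv, hwv⟩ := exists_algebra_trunc_index hw
  have h₁ : ∀ n (x y : Q.toGrAlg.truncDeg v n), y.1 = twist hB (-1) x.1 →
      (((D.trunc hwv).algHom (C.trunc hwv) φ.hom).app n y).1 =
        twist hA.1 (-1) (((D.trunc hwv).algHom (C.trunc hwv) φ.hom).app n x).1 :=
    fun n x y h => by
      obtain rfl : y = D.truncTwist v n (-1) x := Subtype.ext h
      exact congrArg Subtype.val ((D.trunc hwv).algHom_twist (C.trunc hwv) φ.hom (-1) x)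
  have h₂ : ∀ n (x y : A.truncDeg v n), y.1 = twist hA.1 (-1) x.1 →
      (((C.trunc hwv).algHom (D.trunc hwv) φ.inv).app n y).1 =
        twist hB (-1) (((C.trunc hwv).algHom (D.trunc hwv) φ.inv).app n x).1 :=
    fun n x y h => by
      obtain rfl : y = C.truncTwist v n (-1) x := Subtype.ext h
      exact congrArg Subtype.val ((C.trunc hwv).algHom_twist (D.trunc hwv) φ.inv (-1) x)
  obtain ⟨g, hg, hext⟩ := hA.2.2 _ hB (D.leftTorsionfree_iff.1 hQ) v hv
    (isoOfGrAlg ((D.trunc hwv).algIso (C.trunc hwv) φ)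
      (trunc_hom_even h2 hB hA.1 _ h₁) (trunc_hom_odd h2 hB hA.1 _ h₁)
      (trunc_hom_even h2 hA.1 hB _ h₂) (trunc_hom_odd h2 hA.1 hB _ h₂))
  exact C.exists_extension_operad D hwv φ g.toHom
    (fun n u x => g.map_twist hB hA.1 u x) hg hext

theorem Comparison.isSaturatedPGC (h2 : (2 : k) ≠ 0) (hA : A.IsPGC)
    (C : Comparison P A.toGrAlg (fun _ u => twist hA u)) (hP : P.IsSaturated) :
    A.IsSaturatedPGC := by
  refine ⟨hA, C.leftTorsionfree_iff.1 hP.1, fun B hB htB v hv φ => ?_⟩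
  let D := comparisonOfPGC B hB
  have hwv : ∀ n, n ≠ 0 → (v + 1 ≤ n + 1 ↔ v ≤ n) := fun n _ => by omega
  have h₁ : ∀ (n : ℕ) (u : ℤˣ) (x : (B.toGrAlg.trunc v).deg n),
      φ.hom.app n (D.truncTwist v n u x) = C.truncTwist v n u (φ.hom.app n x) :=
    fun n u x => Subtype.ext (twist_trunc_hom hB hA φ.hom u x _ rfl)
  have h₂ : ∀ (n : ℕ) (u : ℤˣ) (x : (A.toGrAlg.trunc v).deg n),
      φ.inv.app n (C.truncTwist v n u x) = D.truncTwist v n u (φ.inv.app n x) :=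
    fun n u x => Subtype.ext (twist_trunc_hom hA hB φ.inv u x _ rfl)
  obtain ⟨f, hf, hext⟩ := hP.2 _ (D.leftTorsionfree_iff.2 htB) (v + 1) (Nat.succ_pos _)
    ((D.trunc hwv).opIso (C.trunc hwv) (isoToGrAlg φ) h₁ h₂)
  have e := fun n x => D.algHom_twist C f (n := n) (-1) x
  refine ⟨⟨D.algHom C f, fun n x hx => mem_even_of_mem_even h2 hB hA
      (fun h => by rw [h, map_zero]) (fun h => ?_) hx,
    fun n x hx => mem_odd_of_mem_odd h2 hB hA
      (fun h => by rw [h, map_zero]) (fun h => ?_) hx⟩,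
    C.exists_extension_algebra D hwv (isoToGrAlg φ) h₁ f hf hext⟩
  · exact (e n x).symm.trans (congrArg _ h)
  · exact (e n x).symm.trans ((congrArg _ h).trans (map_neg _ _))

/-- A product of an even and an odd element lies in both ideals, hence vanishes. As both parts are
stable under twists, they give operadic ideals whose composites are all zero. -/
theorem Comparison.even_eq_bot_or_odd_eq_bot (hA : A.IsPGC)
    (C : Comparison P A.toGrAlg (fun _ u => twist hA u)) (hP : P.IsPrime) :
    (∀ n, A.even n = ⊥) ∨ (∀ n, A.odd n = ⊥) := by
  by_contra! h
  obtain ⟨⟨a, ha⟩, ⟨b, hb⟩⟩ := h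
  have htwist_even : ∀ {n : ℕ} (u : ℤˣ) (x : A.deg n), x ∈ A.even n → twist hA u x ∈ A.even n :=
    fun u x hx => by rwa [twist_even hA u hx]
  have htwist_odd : ∀ {n : ℕ} (u : ℤˣ) (x : A.deg n), x ∈ A.odd n → twist hA u x ∈ A.odd n :=
    fun u x hx => by rw [twist_odd hA u hx]; exact Submodule.smul_mem _ _ hx
  let I : P.TwoSidedIdeal :=
    { carrier := fun n => (A.even n).comap (C.equiv n).toLinearMap
      act_mem := fun σ x hx => by
        rw [Submodule.mem_comap, LinearEquiv.coe_coe] at hx ⊢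
        rw [C.map_act]
        exact htwist_even _ _ hx
      comp_mem_left := fun i z x hx => by
        rw [Submodule.mem_comap, LinearEquiv.coe_coe] at hx ⊢
        rw [C.map_comp]
        exact hA.mul_even _ _ hx
      comp_mem_right := fun i x hx z => by
        rw [Submodule.mem_comap, LinearEquiv.coe_coe] at hx ⊢
        rw [C.map_comp]
        exact hA.even_mul _ (htwist_even _ _ hx) _ }
  let J : P.TwoSidedIdeal :=
    { carrier := fun n => (A.odd n).comap (C.equiv n).toLinearMap
      act_mem := fun σ x hx => by
        rw [Submodule.mem_comap, LinearEquiv.coe_coe] at hx ⊢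
        rw [C.map_act]
        exact htwist_odd _ _ hx
      comp_mem_left := fun i z x hx => by
        rw [Submodule.mem_comap, LinearEquiv.coe_coe] at hx ⊢
        rw [C.map_comp]
        exact hA.mul_odd _ _ hx
      comp_mem_right := fun i x hx z => by
        rw [Submodule.mem_comap, LinearEquiv.coe_coe] at hx ⊢
        rw [C.map_comp]
        exact hA.odd_mul _ (htwist_odd _ _ hx) _ }
  obtain ⟨m, n, i, x, hx, y, hy, hxy⟩ := hP I J ⟨a, C.comap_ne_bot ha⟩ ⟨b, C.comap_ne_bot hb⟩
  refine hxy ((C.equiv _).injective ?_)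
  rw [C.map_comp, map_zero]
  exact even_mul_odd hA (htwist_even _ _ hx) hy

/-- With a single type left, each twist is a scalar in every degree, so all subspaces are stable and
`isPrime_algebra` applies. -/
theorem Comparison.isPrime_PGC (hA : A.IsPGC)
    (C : Comparison P A.toGrAlg (fun _ u => twist hA u)) (hP : P.IsPrime) : A.IsPrime := by
  refine C.isPrime_algebra (fun n u S x hx => ?_) hP
  by_cases hn : n = 0
  · rwa [TypedGrAlg.twist_zero hA hn]
  obtain ⟨e, he, o, ho, rfl⟩ := exists_even_add_odd hA hn x
  rcases C.even_eq_bot_or_odd_eq_bot hA hP with h | h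
  · rw [h, Submodule.mem_bot] at he
    subst he
    rw [zero_add] at hx ⊢
    rw [twist_odd hA u ho]
    exact S.smul_mem _ hx
  · rw [h, Submodule.mem_bot] at ho
    subst ho
    rw [add_zero] at hx ⊢
    rwa [twist_even hA u he]

end ATrivial

end GradedOperads

/-! ### Assembling the equivalences -/

namespace GradedOperads

/-- The functors `(G, F)` restrict to an equivalence if they respect the two classes of objects and
there are natural isomorphisms `F (G A) ≅ A` and `G (F B) ≅ B` on these classes. -/
theorem restrictToEquivalence_of_iso {C D : Type*} [Category C] [Category D] {P : ObjectProperty C}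
    {G : P.FullSubcategory ⥤ D} {F : D ⥤ C} {X : ObjectProperty C} {Y : ObjectProperty D}
    (hX : X ≤ P) (hG : ∀ A (hA : X A), Y (G.obj ⟨A, hX A hA⟩)) (hF : ∀ B, Y B → X (F.obj B))
    (η : ∀ A (hA : X A), A ≅ F.obj (G.obj ⟨A, hX A hA⟩))
    (η_natural : ∀ A B (hA : X A) (hB : X B) (f : A ⟶ B),
      f ≫ (η B hB).hom = (η A hA).hom ≫
        F.map (G.map (ObjectProperty.homMk f : (⟨A, hX A hA⟩ : P.FullSubcategory) ⟶ ⟨B, hX B hB⟩)))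
    (ε : ∀ B (hB : Y B), G.obj ⟨F.obj B, hX _ (hF B hB)⟩ ≅ B)
    (ε_natural : ∀ A B (hA : Y A) (hB : Y B) (f : A ⟶ B),
      G.map (ObjectProperty.homMk (F.map f) :
        (⟨F.obj A, hX _ (hF A hA)⟩ : P.FullSubcategory) ⟶ ⟨F.obj B, hX _ (hF B hB)⟩) ≫
          (ε B hB).hom = (ε A hA).hom ≫ f) :
    RestrictToEquivalence G F X Y :=
  ⟨hX, fun A => hG A.obj A.property, fun B => hF B.obj B.property,
    -- This constructor asks for no triangle identity: it corrects the unit and keeps both functors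
    -- as given, so the required equations of functors hold definitionally.
    CategoryTheory.Equivalence.mk
      (Y.lift (ObjectProperty.ιOfLE hX ⋙ G) fun A => hG A.obj A.property)
      (X.lift (Y.ι ⋙ F) fun B => hF B.obj B.property)
      (NatIso.ofComponents (fun A => X.isoMk (η A.obj A.property)) fun {A B} f =>
        ObjectProperty.hom_ext _ (η_natural A.obj B.obj A.property B.property f.hom))
      (NatIso.ofComponents (fun B => Y.isoMk (ε B.obj B.property)) fun {A B} f =>
        ObjectProperty.hom_ext _ (ε_natural A.obj B.obj A.property B.property f.hom)),
    rfl, rfl⟩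

variable {k : Type u} [Field k]

/-! ### The unit and counit isomorphisms -/

section STrivial

/-- The graded algebra of the operad of a commutative graded algebra. -/
def unitIsoSTr (A : GrAlg k) (hA : GrAlg.isComm k A) : A ≅ (A.toOperad hA).toGrAlg where
  hom := ⟨fun _ => LinearMap.id, rfl, fun _ _ => rfl⟩
  inv := ⟨fun _ => LinearMap.id, rfl, fun _ _ => rfl⟩

/-- The operad of the graded algebra of an `S`-trivial operad. -/
def counitIsoSTr (P : (Operad.isSTrivial k).FullSubcategory)
    (hA : GrAlg.isComm k P.obj.toGrAlg) :
    (GStr k).obj ⟨(FStr k).obj P, hA⟩ ≅ P :=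
  (Operad.isSTrivial k).isoMk
    ((comparisonToOperad P.obj.toGrAlg hA).opIso (comparisonToGrAlg P.obj P.property)
      (Iso.refl _) (fun _ _ _ => rfl) (fun _ _ _ => rfl))

theorem restrictToEquivalence_STr {X : ObjectProperty (GrAlg k)}
    {Y : ObjectProperty (Operad.isSTrivial k).FullSubcategory} (hX : X ≤ GrAlg.isComm k)
    (hG : ∀ A (hA : X A), Y ((GStr k).obj ⟨A, hX A hA⟩)) (hF : ∀ B, Y B → X ((FStr k).obj B)) :
    RestrictToEquivalence (GStr k) (FStr k) X Y :=
  restrictToEquivalence_of_iso hX hG hF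
    (fun A hA => unitIsoSTr A (hX A hA)) (fun _ _ _ _ _ => rfl)
    (fun P hP => counitIsoSTr P (hX _ (hF P hP))) (fun _ _ _ _ _ => rfl)

theorem isSaturated_GStr (A : GrAlg k) (hA : GrAlg.isComm k A) (h : A.IsSaturated) :
    ((GStr k).obj ⟨A, hA⟩).obj.IsSaturated :=
  (comparisonToOperad A hA).isSaturated_operad (fun _ _ _ => rfl) h

theorem isSaturated_FStr (P : (Operad.isSTrivial k).FullSubcategory) (h : P.obj.IsSaturated) :
    ((FStr k).obj P).IsSaturated ∧ GrAlg.isComm k ((FStr k).obj P) :=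
  have hc := Operad.isComm_toGrAlg P.property h.1
  ⟨(comparisonToGrAlg P.obj P.property).isSaturated_algebra hc h, hc⟩

end STrivial

section ATrivial

open TypedGrAlg

/-- The graded algebra with types of the operad of a PGC algebra. -/
def unitIsoATr (h2 : (2 : k) ≠ 0) (A : TypedGrAlg k) (hA : A.IsPGC) :
    A ≅ (A.toOperad hA).toTypedGrAlg where
  hom :=
    { app := fun _ => LinearMap.id
      map_one := rfl
      map_mul := fun x y => (comparisonOfPGC A hA).map_comp_zero x y |>.symm
      map_even := fun n x hx => by
        cases n with
        | zero => rwa [A.even_zero] at hx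
        | succ n => exact fun σ => twist_even hA _ hx
      map_odd := fun n x hx => by
        cases n with
        | zero => rwa [A.odd_zero] at hx
        | succ n => exact fun σ => twist_odd hA _ hx }
  inv :=
    { app := fun _ => LinearMap.id
      map_one := rfl
      map_mul := fun x y => (comparisonOfPGC A hA).map_comp_zero x y
      map_even := fun n x hx => by
        cases n with
        | zero => rwa [A.even_zero]
        | succ n =>
          -- One odd permutation detects the eigenspace of the twist; `h2` then places `x` in the
          -- even part.
          have := hx (Equiv.swap 0 (Fin.last (n + 1)))
          refine mem_even_of_twist h2 hA n.succ_ne_zero ?_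
          rwa [← sign_swap_zero_last n.succ_ne_zero]
      map_odd := fun n x hx => by
        cases n with
        | zero => rwa [A.odd_zero]
        | succ n =>
          have := hx (Equiv.swap 0 (Fin.last (n + 1)))
          refine mem_odd_of_twist h2 hA n.succ_ne_zero ?_
          rw [← sign_swap_zero_last n.succ_ne_zero]
          refine this.trans ?_
          rw [sign_swap_zero_last n.succ_ne_zero]
          simp }

/-- The operad of the PGC algebra of a left torsionfree `A`-trivial operad. -/
def counitIsoATr (P : (Operad.isATrivial k).FullSubcategory) (ht : P.obj.LeftTorsionfree)
    (hA : P.obj.toTypedGrAlg.IsPGC) : (GAtr k).obj ⟨(FAtr k).obj P, hA⟩ ≅ P :=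
  (Operad.isATrivial k).isoMk
    ((comparisonOfPGC P.obj.toTypedGrAlg hA).opIso
      (comparisonToTypedGrAlg P.obj P.property ht hA)
      (Iso.refl _) (fun _ _ _ => rfl) (fun _ _ _ => rfl))

/-- The condition `hY` serves the counit: rebuilding the compositions at all inputs from the one at
input `0` uses torsionfreeness. -/
theorem restrictToEquivalence_ATr (h2 : (2 : k) ≠ 0) {X : ObjectProperty (TypedGrAlg k)}
    {Y : ObjectProperty (Operad.isATrivial k).FullSubcategory} (hX : X ≤ TypedGrAlg.isPGC k)
    (hY : ∀ P, Y P → P.obj.LeftTorsionfree)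
    (hG : ∀ A (hA : X A), Y ((GAtr k).obj ⟨A, hX A hA⟩)) (hF : ∀ B, Y B → X ((FAtr k).obj B)) :
    RestrictToEquivalence (GAtr k) (FAtr k) X Y :=
  restrictToEquivalence_of_iso hX hG hF
    (fun A hA => unitIsoATr h2 A (hX A hA)) (fun _ _ _ _ _ => rfl)
    (fun P hP => counitIsoATr P (hY P hP) (hX _ (hF P hP))) (fun _ _ _ _ _ => rfl)

theorem isSaturated_GAtr (h2 : (2 : k) ≠ 0) (A : TypedGrAlg k) (h : A.IsSaturatedPGC) :
    ((GAtr k).obj ⟨A, h.1⟩).obj.IsSaturated :=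
  (comparisonOfPGC A h.1).isSaturated_of_isSaturatedPGC h2 h ((GAtr k).obj ⟨A, h.1⟩).property

theorem isSaturatedPGC_FAtr (h2 : (2 : k) ≠ 0) (P : (Operad.isATrivial k).FullSubcategory)
    (h : P.obj.IsSaturated) : ((FAtr k).obj P).IsSaturatedPGC :=
  have hA := Operad.isPGC_toTypedGrAlg h2 P.property h.1
  (comparisonToTypedGrAlg P.obj P.property h.1 hA).isSaturatedPGC
    (A := P.obj.toTypedGrAlg) h2 hA h

end ATrivial

end GradedOperads

/-! ### The theorem -/

open GradedOperads

theorem theorem4p5 (k : Type u) [Field k] :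
    (ringChar k ≠ 2 →
      RestrictToEquivalence (GAtr k) (FAtr k)
        (fun A => A.IsSaturatedPGC)
        (fun P => P.obj.IsSaturated) ∧
      RestrictToEquivalence (GAtr k) (FAtr k)
        (fun A => A.InfiniteDimensional ∧ A.IsPrime ∧ A.IsSaturatedPGC)
        (fun P => P.obj.InfiniteDimensional ∧ P.obj.IsPrime ∧ P.obj.IsSaturated)) ∧
    (RestrictToEquivalence (GStr k) (FStr k)
        (fun A => A.IsSaturated ∧ GrAlg.isComm k A)
        (fun P => P.obj.IsSaturated) ∧
      RestrictToEquivalence (GStr k) (FStr k)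
        (fun A => A.InfiniteDimensional ∧ A.IsPrime ∧ A.IsSaturated ∧ GrAlg.isComm k A)
        (fun P => P.obj.InfiniteDimensional ∧ P.obj.IsPrime ∧ P.obj.IsSaturated)) := by
  refine ⟨fun hchar => ?_, ?_, ?_⟩
  · have h2 : (2 : k) ≠ 0 := Ring.two_ne_zero hchar
    refine ⟨restrictToEquivalence_ATr h2 (fun A hA => hA.1) (fun P hP => hP.1)
      (fun A hA => isSaturated_GAtr h2 A hA) (fun P hP => isSaturatedPGC_FAtr h2 P hP),
      restrictToEquivalence_ATr h2 (fun A hA => hA.2.2.1) (fun P hP => hP.2.2.1)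
        (fun A hA => ?_) (fun P hP => ?_)⟩
    · have C := comparisonOfPGC A hA.2.2.1
      exact ⟨C.infiniteDimensional_iff.2 hA.1, C.isPrime_operad hA.2.1,
        isSaturated_GAtr h2 A hA.2.2⟩
    · have hA := Operad.isPGC_toTypedGrAlg h2 P.property hP.2.2.1
      have C := comparisonToTypedGrAlg P.obj P.property hP.2.2.1 hA
      exact ⟨C.infiniteDimensional_iff.1 hP.1,
        C.isPrime_PGC (A := P.obj.toTypedGrAlg) hA hP.2.1, isSaturatedPGC_FAtr h2 P hP.2.2⟩
  · exact restrictToEquivalence_STr (fun A hA => hA.2)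
      (fun A hA => isSaturated_GStr A hA.2 hA.1) (fun P hP => isSaturated_FStr P hP)
  · refine restrictToEquivalence_STr (fun A hA => hA.2.2.2) (fun A hA => ?_) (fun P hP => ?_)
    · have C := comparisonToOperad A hA.2.2.2
      exact ⟨C.infiniteDimensional_iff.2 hA.1, C.isPrime_operad hA.2.1,
        isSaturated_GStr A hA.2.2.2 hA.2.2.1⟩
    · have C := comparisonToGrAlg P.obj P.property
      exact ⟨C.infiniteDimensional_iff.1 hP.1,
        C.isPrime_algebra (fun _ _ _ _ h => h) hP.2.1, isSaturated_FStr P hP.2.2⟩
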